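/- **Setting.** Let $\Omega\subseteq\mathbb R^n$ be open, $m,K\in\mathbb N$, let $M$ be the number of pairs $(i,\alpha)$ with $1\le i\le K$ and $\alpha$ a multi-index with $|\alpha|\le m$, and let $\mathbf F=(F_1,\dots,F_K):\Omega\times\mathbb R^M\to\mathbb R^K$ be (jointly) continuous. For $u:\Omega\to\overline{\mathbb R}$ put $$I(u)(x)=\sup_{\delta>0}\ \inf\{u(y):y\in\Omega,\ \|x-y\|<\delta\},\qquad S(u)(x)=\inf_{\delta>0}\ \sup\{u(y):y\in\Omega,\ \|x-y\|<\delta\}.$$ $\mathcal{NL}(\Omega)$ is the set of $u:\Omega\to\overline{\mathbb R}$ with $(I\circ S)(u)=u$ that are finite on some open dense subset of $\Omega$. For $l\ge 0$, $\mathcal{ML}^l(\Omega)$ is the set of $u\in\mathcal{NL}(\Omega)$ for which there is a closed nowhere dense $\Gamma\subset\Omega$ such that $u$ is real-valued and of class $C^l$ on $\Omega\setminus\Gamma$; it is ordered pointwise. For $|\alpha|\le l$ let $\mathcal D^\alpha:\mathcal{ML}^l(\Omega)\to\mathcal{ML}^0(\Omega)$, $\mathcal D^\alpha u=(I\circ S)(D^\alpha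 u)$. (The values assigned to $D^\alpha u$ on a closed nowhere dense set off which $u$ is $C^l$ do not affect the result; likewise for $T_j$ below.) A *uniform convergence structure* on a set $X$ is a family $\mathcal J$ of filters on $X\times X$ that contains $[x]\times[x]$ for all $x\in X$ and is closed under finite intersections, finer filters, inversion, and composition whenever it exists. A map $f$ is *uniformly continuous* if $(f\times f)(\mathcal U)$ is in the structure of the target for every $\mathcal U$ in that of the domain. A filter $\mathcal G$ converges to $x$ if $\mathcal G\times[x]\in\mathcal J$ and is Cauchy if $\mathcal G\times\mathcal G\in\mathcal J$. The space is Hausdorff if limits are unique, and complete if Cauchy filters converge. A *completion* of $X$ is a complete Hausdorff uniform convergence space $X^\sharp$ with a uniform embedding $X\to X^\sharp$ with dense range, such that every uniformly continuous map from $X$ into a complete Hausdorff uniform convergence space extends uniquely to a uniformly continuous map on $X^\sharp$. $\mathcal J_o$ is the family of filters $\mathcal U$ on $\mathcal{ML}^0(\Omega)\times\mathcal{ML}^0(\Omega)$ for which there are $k\in\mathbb N$ and, for $i=1,\dots,k$, a sequence of nonempty order intervals $I^i_1\supseteq I^i_2\supseteq\cdots$ of $\mathcal{ML}^0(\Omega)$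 such that for every open $V\subseteq\Omega$ the set $\bigcap_r I^i_{r|V}$ (where $I^i_{r|V}$ is the set of restrictions to $V$ of the elements of $I^i_r$) is empty or equals $\{w\}$ for some $w\in\mathcal{ML}^0(V)$, and $\bigcap_{i=1}^k(\mathcal I^i\times\mathcal I^i)\subseteq\mathcal U$, where $\mathcal I^i$ is the filter generated by $\{I^i_r:r\in\mathbb N\}$. $\mathcal J_D$ is the initial structure on $\mathcal{ML}^m(\Omega)$ for the maps $\mathcal D^\alpha$, $|\alpha|\le m$: $\mathcal U\in\mathcal J_D$ iff $(\mathcal D^\alpha\times\mathcal D^\alpha)(\mathcal U)\in\mathcal J_o$ for all $|\alpha|\le m$. $\mathcal J_o^K$ and $\mathcal J_D^K$ are the product structures: $\mathcal U$ belongs to them iff all $(\pi_i\times\pi_i)(\mathcal U)$ belong to $\mathcal J_o$, respectively $\mathcal J_D$. **Theorem.** The operator $\mathbf T:\mathcal{ML}^m(\Omega)^K\to\mathcal{ML}^0(\Omega)^K$ with components $$T_j\mathbf u=(I\circ S)\bigl(F_j(\cdot,\dots,\mathcal D^\alpha u_i,\dots)\bigr),\qquad j=1,\dots,K,\quad |\alpha|\le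 m,\ 1\le i\le K,$$ is uniformly continuous with respect to $\mathcal J_D^K$ and $\mathcal J_o^K$. Moreover $(\mathcal{ML}^m(\Omega)^K,\mathcal J_D^K)$ and $(\mathcal{ML}^0(\Omega)^K,\mathcal J_o^K)$ have completions, and for any completions $\psi:\mathcal{ML}^m(\Omega)^K\to X^\sharp$ and $\varphi:\mathcal{ML}^0(\Omega)^K\to Y^\sharp$ there is exactly one uniformly continuous $\mathbf T^\sharp:X^\sharp\to Y^\sharp$ with $\mathbf T^\sharp\circ\psi=\varphi\circ\mathbf T$. -/

import Mathlib

open Filter Topology TopologicalSpace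

namespace OrderCompletion

/-! ### Uniform convergence spaces

Filters are allowed to be improper; since a uniform convergence structure is closed under passing
to finer filters, this only adds the improper filter `⊥` to each structure. An intersection of
filters, viewed as families of sets, is a supremum `⊔` in the order of `Filter`, and
`𝒰 ⊆ 𝒱` as families of sets is `𝒱 ≤ 𝒰`. -/

section UniformConvergence

variable {X Y Z : Type}

/-- The composition of two filters on `X × X`, generated by the compositions of their members. -/
def compFilter (U V : Filter (X × X)) : Filter (X × X) :=
  U.lift fun s => V.lift' fun t => {p : X × X | ∃ z, (p.1, z) ∈ t ∧ (z, p.2) ∈ s}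

/-- `J` is a uniform convergence structure on `X`. -/
structure IsUniformConvergenceStructure (J : Set (Filter (X × X))) : Prop where
  pure_mem : ∀ x : X, (pure x ×ˢ pure x : Filter (X × X)) ∈ J
  sup_mem : ∀ U ∈ J, ∀ V ∈ J, U ⊔ V ∈ J
  mono : ∀ U ∈ J, ∀ V, V ≤ U → V ∈ J
  swap_mem : ∀ U ∈ J, map Prod.swap U ∈ J
  comp_mem : ∀ U ∈ J, ∀ V ∈ J, compFilter U V ∈ J

/-- Convergence of a filter to a point in a uniform convergence space. -/
def ConvergesTo (J : Set (Filter (X × X))) (f : Filter X) (x : X) : Prop :=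
  f ×ˢ pure x ∈ J

/-- Cauchy filters of a uniform convergence space. -/
def IsCauchy (J : Set (Filter (X × X))) (f : Filter X) : Prop :=
  f.NeBot ∧ f ×ˢ f ∈ J

/-- Limits are unique. -/
def IsHausdorff (J : Set (Filter (X × X))) : Prop :=
  ∀ (f : Filter X) (x y : X), f.NeBot → ConvergesTo J f x → ConvergesTo J f y → x = y

/-- Every Cauchy filter converges. -/
def IsCompleteUCS (J : Set (Filter (X × X))) : Prop :=
  ∀ f : Filter X, IsCauchy J f → ∃ x, ConvergesTo J f x

/-- Uniform continuity of a mapping between uniform convergence spaces. -/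
def UnifContinuous (JX : Set (Filter (X × X))) (JY : Set (Filter (Y × Y))) (f : X → Y) : Prop :=
  ∀ U ∈ JX, map (Prod.map f f) U ∈ JY

/-- The product uniform convergence structure on a power of `X`. -/
def productStructure (ι : Type) (J : Set (Filter (X × X))) :
    Set (Filter ((ι → X) × (ι → X))) :=
  {U | ∀ i : ι, map (Prod.map (fun u : ι → X => u i) (fun u : ι → X => u i)) U ∈ J}

/-- `(X', J')`, together with `e : X → X'`, is the completion of the uniform convergence space
`(X, J)`: it is a complete Hausdorff uniform convergence space, `e` is a uniform embedding with
dense range, and every uniformly continuous mapping of `(X, J)` into a complete Hausdorff uniform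
convergence space extends uniquely to a uniformly continuous mapping on `(X', J')`. -/
structure IsCompletion {X' : Type} (J : Set (Filter (X × X))) (J' : Set (Filter (X' × X')))
    (e : X → X') : Prop where
  isUCS : IsUniformConvergenceStructure J'
  hausdorff : IsHausdorff J'
  complete : IsCompleteUCS J'
  injective : Function.Injective e
  embedding : ∀ U : Filter (X × X), U ∈ J ↔ map (Prod.map e e) U ∈ J'
  dense : ∀ p : X', ∃ f : Filter X, f.NeBot ∧ ConvergesTo J' (map e f) p
  extend : ∀ (Z : Type) (JZ : Set (Filter (Z × Z))), IsUniformConvergenceStructure JZ →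
    IsHausdorff JZ → IsCompleteUCS JZ → ∀ f : X → Z, UnifContinuous J JZ f →
      ∃! g : X' → Z, UnifContinuous J' JZ g ∧ g ∘ e = f

end UniformConvergence

/-! ### Baire operators -/

section Baire

variable {X : Type} [PseudoMetricSpace X]

/-- The lower Baire operator `I`. -/
noncomputable def lowerBaire (u : X → EReal) (x : X) : EReal :=
  ⨆ (δ : ℝ) (_ : 0 < δ), ⨅ y ∈ Metric.ball x δ, u y

/-- The upper Baire operator `S`. -/
noncomputable def upperBaire (u : X → EReal) (x : X) : EReal :=
  ⨅ (δ : ℝ) (_ : 0 < δ), ⨆ y ∈ Metric.ball x δ, u y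

/-- The composition `I ∘ S`. -/
noncomputable def baireIS (u : X → EReal) : X → EReal := lowerBaire (upperBaire u)

/-- Nearly finite normal lower semi-continuous functions: `(I ∘ S) u = u`, and `u` is finite on
some open and dense set. -/
def IsNL (u : X → EReal) : Prop :=
  baireIS u = u ∧ ∃ D : Set X, IsOpen D ∧ Dense D ∧ ∀ x ∈ D, u x ≠ ⊤ ∧ u x ≠ ⊥

lemma lowerBaire_mono {u v : X → EReal} (h : u ≤ v) : lowerBaire u ≤ lowerBaire v :=
  fun _ => iSup₂_mono fun _ _ => iInf₂_mono fun y _ => h y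

lemma upperBaire_mono {u v : X → EReal} (h : u ≤ v) : upperBaire u ≤ upperBaire v :=
  fun _ => iInf₂_mono fun _ _ => iSup₂_mono fun y _ => h y

lemma lowerBaire_le (u : X → EReal) : lowerBaire u ≤ u := fun x =>
  iSup₂_le fun _ hδ => iInf₂_le x (Metric.mem_ball_self hδ)

lemma le_upperBaire (u : X → EReal) : u ≤ upperBaire u := fun x =>
  le_iInf₂ fun _ hδ => le_iSup₂ (f := fun y _ => u y) x (Metric.mem_ball_self hδ)

lemma lowerBaire_idem (u : X → EReal) : lowerBaire (lowerBaire u) = lowerBaire u := by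
  refine le_antisymm (lowerBaire_le _) fun x => iSup₂_le fun δ hδ => ?_
  refine le_iSup₂_of_le (δ / 2) (half_pos hδ) (le_iInf₂ fun y hy => ?_)
  refine le_iSup₂_of_le (δ / 2) (half_pos hδ) (le_iInf₂ fun z hz => iInf₂_le z ?_)
  rw [Metric.mem_ball] at *
  linarith [dist_triangle z y x]

lemma upperBaire_idem (u : X → EReal) : upperBaire (upperBaire u) = upperBaire u := by
  refine le_antisymm (fun x => le_iInf₂ fun δ hδ => ?_) (le_upperBaire _)
  refine iInf₂_le_of_le (δ / 2) (half_pos hδ) (iSup₂_le fun y hy => ?_)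
  refine iInf₂_le_of_le (δ / 2) (half_pos hδ)
    (iSup₂_le fun z hz => le_iSup₂ (f := fun y _ => u y) z ?_)
  rw [Metric.mem_ball] at *
  linarith [dist_triangle z y x]

lemma baireIS_idem (u : X → EReal) : baireIS (baireIS u) = baireIS u := by
  unfold baireIS
  refine le_antisymm ?_ ?_
  · refine lowerBaire_mono ((upperBaire_mono (lowerBaire_le _)).trans (upperBaire_idem u).le)
  · conv_lhs => rw [← lowerBaire_idem]
    exact lowerBaire_mono (le_upperBaire _)

lemma upperBaire_eq_of_continuousAt {u : X → EReal} {x : X} (h : ContinuousAt u x) :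
    upperBaire u x = u x := by
  refine le_antisymm (le_of_forall_gt_imp_ge_of_dense fun c hc => ?_) (le_upperBaire u x)
  obtain ⟨δ, hδ, hb⟩ := Metric.eventually_nhds_iff_ball.1 (h.eventually_lt_const hc)
  exact iInf₂_le_of_le δ hδ (iSup₂_le fun y hy => (hb y hy).le)

lemma lowerBaire_eq_of_continuousAt {u : X → EReal} {x : X} (h : ContinuousAt u x) :
    lowerBaire u x = u x := by
  refine le_antisymm (lowerBaire_le u x) (le_of_forall_lt_imp_le_of_dense fun c hc => ?_)
  obtain ⟨δ, hδ, hb⟩ := Metric.eventually_nhds_iff_ball.1 (h.eventually_const_lt hc)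
  exact le_iSup₂_of_le δ hδ (le_iInf₂ fun y hy => (hb y hy).le)

lemma baireIS_eq_of_continuousOn {u : X → EReal} {D : Set X} (hD : IsOpen D)
    (h : ContinuousOn u D) {x : X} (hx : x ∈ D) : baireIS u x = u x := by
  have h1 : ∀ y ∈ D, upperBaire u y = u y := fun y hy =>
    upperBaire_eq_of_continuousAt (h.continuousAt (hD.mem_nhds hy))
  have h2 : ContinuousAt (upperBaire u) x :=
    (h.continuousAt (hD.mem_nhds hx)).congr
      (Filter.eventually_of_mem (hD.mem_nhds hx) fun y hy => (h1 y hy).symm)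
  rw [baireIS, lowerBaire_eq_of_continuousAt h2, h1 x hx]

end Baire

/-! ### The spaces `ML^l(Ω)` and the extended partial differential operators -/

/-- `ℝⁿ` with its Euclidean norm. -/
abbrev E (n : ℕ) : Type := EuclideanSpace ℝ (Fin n)

section Spaces

variable {n : ℕ}

open Classical in
/-- The real-valued function on `ℝⁿ` that agrees with `u` at the points of `Ω` where `u` is finite,
with the value `0` elsewhere; it is only used on open sets where `u` is finite. -/
noncomputable def realPart {Ω : Opens (E n)} (u : Ω → EReal) : E n → ℝ :=
  fun y => if h : y ∈ Ω then (u ⟨y, h⟩).toReal else 0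

/-- Nearly finite normal lower semi-continuous functions on `Ω` that are (real-valued and) of
class `C^l` off some closed nowhere dense subset `Γ` of `Ω`. -/
def IsML {Ω : Opens (E n)} (l : ℕ) (u : Ω → EReal) : Prop :=
  IsNL u ∧ ∃ Γ : Set Ω, IsClosed Γ ∧ IsNowhereDense Γ ∧
    (∀ x ∉ Γ, u x ≠ ⊤ ∧ u x ≠ ⊥) ∧ ContDiffOn ℝ l (realPart u) (Subtype.val '' Γᶜ)

/-- The space `ML^l(Ω)`, ordered pointwise. -/
abbrev ML (Ω : Opens (E n)) (l : ℕ) : Type := {u : Ω → EReal // IsML l u}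

/-- Multi-indices `α` in dimension `n` with `|α| ≤ l`. -/
abbrev MultiIndex (n l : ℕ) : Type := {α : Fin n → ℕ // ∑ i, α i ≤ l}

/-- The partial derivative in the `i`-th coordinate. -/
noncomputable def partialD (i : Fin n) (f : E n → ℝ) : E n → ℝ :=
  fun x => lineDeriv ℝ f x (EuclideanSpace.single i (1 : ℝ))

/-- The iterated partial derivative `D^α`. -/
noncomputable def multiD (α : Fin n → ℕ) (f : E n → ℝ) : E n → ℝ :=
  (List.finRange n).foldr (fun i g => (partialD i)^[α i] g) f

lemma contDiffOn_partialD {U : Set (E n)} (hU : IsOpen U) (i : Fin n) (k : ℕ) {f : E n → ℝ}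
    (hf : ContDiffOn ℝ (k + 1 : ℕ) f U) : ContDiffOn ℝ k (partialD i f) U := by
  have h1 : ContDiffOn ℝ k (fun x => fderiv ℝ f x (EuclideanSpace.single i (1 : ℝ))) U :=
    (hf.fderiv_of_isOpen hU (by norm_cast)).clm_apply contDiffOn_const
  refine h1.congr fun x hx => ?_
  have : DifferentiableAt ℝ f x :=
    (hf.differentiableOn (by simp)).differentiableAt (hU.mem_nhds hx)
  exact this.lineDeriv_eq_fderiv

lemma contDiffOn_iterate_partialD {U : Set (E n)} (hU : IsOpen U) (i : Fin n) (a k : ℕ)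
    {f : E n → ℝ} (hf : ContDiffOn ℝ (k + a : ℕ) f U) :
    ContDiffOn ℝ k ((partialD i)^[a] f) U := by
  induction a generalizing k with
  | zero => simpa using hf
  | succ a ih =>
    rw [Function.iterate_succ_apply']
    exact contDiffOn_partialD hU i k (ih (k + 1) (by
      have h : k + 1 + a = k + (a + 1) := by ring
      rwa [h]))

lemma contDiffOn_multiD {U : Set (E n)} (hU : IsOpen U) (α : Fin n → ℕ) (k : ℕ)
    {f : E n → ℝ} (hf : ContDiffOn ℝ (k + ∑ i, α i : ℕ) f U) :
    ContDiffOn ℝ k (multiD α f) U := by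
  rw [Fin.sum_univ_def] at hf
  unfold multiD
  generalize List.finRange n = L at hf
  induction L generalizing k with
  | nil => simpa using hf
  | cons i L ih =>
    refine contDiffOn_iterate_partialD hU i (α i) k (ih (k + α i) ?_)
    rwa [List.map_cons, List.sum_cons, ← add_assoc] at hf

variable {Ω : Opens (E n)}

lemma isOpen_image_val {D : Set Ω} (hD : IsOpen D) : IsOpen (Subtype.val '' D : Set (E n)) :=
  Ω.isOpen.isOpenEmbedding_subtypeVal.isOpenMap D hD

lemma realPart_val (u : Ω → EReal) (x : Ω) : realPart u x = (u x).toReal := by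
  simp [realPart]

/-- `I ∘ S` maps functions that are real-valued and continuous off a closed nowhere dense set into
`ML^0(Ω)`, whatever their values on that set are. -/
lemma isML_baireIS (v : Ω → ℝ) {Γ : Set Ω} (h1 : IsClosed Γ) (h2 : IsNowhereDense Γ)
    (hv : ContinuousOn v Γᶜ) : IsML 0 (baireIS fun x => (v x : EReal)) := by
  obtain ⟨hO, hD⟩ := isClosed_isNowhereDense_iff_compl.1 ⟨h1, h2⟩
  have heq : ∀ x ∈ Γᶜ, baireIS (fun x => (v x : EReal)) x = v x := fun x hx =>
    baireIS_eq_of_continuousOn hO (continuous_coe_real_ereal.comp_continuousOn hv) hx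
  have hfin : ∀ x ∈ Γᶜ, baireIS (fun x => (v x : EReal)) x ≠ ⊤ ∧
      baireIS (fun x => (v x : EReal)) x ≠ ⊥ := fun x hx => by
    rw [heq x hx]; exact ⟨EReal.coe_ne_top _, EReal.coe_ne_bot _⟩
  refine ⟨⟨baireIS_idem _, Γᶜ, hO, hD, hfin⟩, Γ, h1, h2, hfin, ?_⟩
  rw [Nat.cast_zero, contDiffOn_zero]
  have hi : Topology.IsInducing (Subtype.val : Ω → E n) := Topology.IsInducing.subtypeVal
  rw [hi.continuousOn_image_iff]
  refine hv.congr fun x hx => ?_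
  rw [Function.comp_apply, realPart_val, heq x hx, EReal.toReal_coe]

lemma isML_extD {l : ℕ} (α : MultiIndex n l) {u : Ω → EReal} (hu : IsML l u) :
    IsML 0 (baireIS fun x : Ω => (multiD α.1 (realPart u) (x : E n) : EReal)) := by
  obtain ⟨-, Γ, h1, h2, -, h4⟩ := hu
  have hO := isOpen_image_val h1.isOpen_compl
  refine isML_baireIS (fun x : Ω => multiD α.1 (realPart u) (x : E n)) h1 h2 ?_
  have h5 : ContDiffOn ℝ (0 : ℕ) (multiD α.1 (realPart u)) (Subtype.val '' Γᶜ) :=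
    contDiffOn_multiD hO α.1 0 (h4.of_le (by exact_mod_cast (zero_add _).trans_le α.2))
  exact h5.continuousOn.comp continuous_subtype_val.continuousOn fun x hx => ⟨x, hx, rfl⟩

/-- The extended partial differential operator `𝒟^α u = (I ∘ S)(D^α u)`, for `|α| ≤ l`. (The
values that `D^α u` receives on the closed nowhere dense set off which `u` is of class `C^l` do
not affect `(I ∘ S)(D^α u)`.) -/
noncomputable def extD {l : ℕ} (α : MultiIndex n l) (u : ML Ω l) : ML Ω 0 :=
  ⟨baireIS fun x : Ω => (multiD α.1 (realPart u.1) (x : E n) : EReal), isML_extD α u.2⟩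

/-! ### The uniform convergence structures -/

/-- Restriction of a function on `Ω` to an open subset `V`. -/
def restrictTo {V : Opens (E n)} (hV : V ≤ Ω) (u : Ω → EReal) : V → EReal :=
  fun x => u ⟨x, hV x.2⟩

/-- The intersection over `k` of the restrictions to `V` of the sets `I k`. -/
def interRestrict (I : ℕ → Set (ML Ω 0)) {V : Opens (E n)} (hV : V ≤ Ω) : Set (V → EReal) :=
  ⋂ k, (fun u : ML Ω 0 => restrictTo hV u.1) '' I k

/-- A decreasing sequence of nonempty order intervals of `ML^0(Ω)` such that, for every open
`V ⊆ Ω`, the intersection of the restrictions to `V` is empty or consists of a single element of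
`ML^0(V)`. -/
structure IsAdmissible (I : ℕ → Set (ML Ω 0)) : Prop where
  interval : ∀ k, ∃ a b : ML Ω 0, I k = Set.Icc a b
  nonempty : ∀ k, (I k).Nonempty
  decreasing : ∀ k, I (k + 1) ⊆ I k
  inter : ∀ (V : Opens (E n)) (hV : V ≤ Ω),
    interRestrict I hV = ∅ ∨ ∃ w : ML V 0, interRestrict I hV = {w.1}

/-- The uniform order convergence structure `J_o` on `ML^0(Ω)`. -/
def orderStructure (Ω : Opens (E n)) : Set (Filter (ML Ω 0 × ML Ω 0)) :=
  {U | ∃ (k : ℕ) (I : Fin k → ℕ → Set (ML Ω 0)), (∀ i, IsAdmissible (I i)) ∧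
    U ≤ ⨆ i, (⨅ r, 𝓟 (I i r)) ×ˢ (⨅ r, 𝓟 (I i r))}

/-- The initial uniform convergence structure `J_D` on `ML^l(Ω)` with respect to the mappings
`𝒟^α : ML^l(Ω) → ML^0(Ω)`, `|α| ≤ l`. -/
def initialStructure (Ω : Opens (E n)) (l : ℕ) : Set (Filter (ML Ω l × ML Ω l)) :=
  {U | ∀ α : MultiIndex n l, map (Prod.map (extD α) (extD α)) U ∈ orderStructure Ω}

/-! ### The nonlinear operator -/

instance (n l : ℕ) : Finite (MultiIndex n l) := by
  refine Finite.of_injective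
    (fun (α : MultiIndex n l) (i : Fin n) => (⟨α.1 i, Nat.lt_succ_of_le
      ((Finset.single_le_sum (fun _ _ => Nat.zero_le _) (Finset.mem_univ i)).trans α.2)⟩ :
        Fin (l + 1))) fun α β h => ?_
  ext i
  exact congrArg Fin.val (congrFun h i)

/-- The function `x ↦ F_j(x, …, 𝒟^α u_i(x), …)`. (Its values at points where some `𝒟^α u_i` is
infinite do not affect its image under `I ∘ S`.) -/
noncomputable def substF {K m : ℕ} (F : Ω × (Fin K × MultiIndex n m → ℝ) → Fin K → ℝ)
    (u : Fin K → ML Ω m) (j : Fin K) : Ω → ℝ :=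
  fun x => F (x, fun p => ((extD p.2 (u p.1)).1 x).toReal) j

lemma isML_substF {K m : ℕ} {F : Ω × (Fin K × MultiIndex n m → ℝ) → Fin K → ℝ}
    (hF : Continuous F) (u : Fin K → ML Ω m) (j : Fin K) :
    IsML 0 (baireIS fun x => (substF F u j x : EReal)) := by
  choose Γ h1 h2 _ h4 using fun p : Fin K × MultiIndex n m => (extD p.2 (u p.1)).2.2
  have hO : ∀ p, IsOpen (Γ p)ᶜ ∧ Dense (Γ p)ᶜ := fun p =>
    isClosed_isNowhereDense_iff_compl.1 ⟨h1 p, h2 p⟩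
  have hU : IsOpen (⋂ p, (Γ p)ᶜ) := isOpen_iInter_of_finite fun p => (hO p).1
  have : LocallyCompactSpace Ω := Ω.isOpen.locallyCompactSpace
  have hD : Dense (⋂ p, (Γ p)ᶜ) :=
    dense_iInter_of_isOpen (fun p => (hO p).1) fun p => (hO p).2
  have hc : IsClosed (⋃ p, Γ p) ∧ IsNowhereDense (⋃ p, Γ p) := by
    rw [isClosed_isNowhereDense_iff_compl, Set.compl_iUnion]
    exact ⟨hU, hD⟩
  refine isML_baireIS (substF F u j) hc.1 hc.2 ?_
  have hcont : ContinuousOn (fun x : Ω => (x, fun p : Fin K × MultiIndex n m =>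
      ((extD p.2 (u p.1)).1 x).toReal)) (⋃ p, Γ p)ᶜ := by
    refine continuousOn_id.prodMk (continuousOn_pi.2 fun p => ?_)
    have h5 := ((h4 p).continuousOn.comp continuous_subtype_val.continuousOn
      (fun x hx => ⟨x, hx, rfl⟩ : Set.MapsTo Subtype.val (Γ p)ᶜ (Subtype.val '' (Γ p)ᶜ)))
    refine (h5.mono (Set.compl_subset_compl.2 (Set.subset_iUnion Γ p))).congr fun x _ => ?_
    rw [Function.comp_apply, realPart_val]
  exact ((continuous_apply j).comp hF).comp_continuousOn hcont

/-- The mapping `T : ML^m(Ω)^K → ML^0(Ω)^K` with components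
`T_j u = (I ∘ S)(F_j(·, …, 𝒟^α u_i, …))`, associated with a jointly continuous `F`. -/
noncomputable def operatorT {K m : ℕ} (F : Ω × (Fin K × MultiIndex n m → ℝ) → Fin K → ℝ)
    (hF : Continuous F) (u : Fin K → ML Ω m) : Fin K → ML Ω 0 :=
  fun j => ⟨baireIS fun x => (substF F u j x : EReal), isML_substF hF u j⟩

end Spaces

end OrderCompletion

/-!
Both halves of the theorem rest on a description of the order structure by Baire category. An
element of `ML^0(Ω)` is finite and continuous on a dense open set and is determined there, so two
elements are compared at the points of any residual set (`ML.le_iff_residual`). A decreasing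
sequence of intervals `[a r, b r]` satisfies the condition on the restrictions to open sets if and
only if, outside a meagre set, `a r` and `b r` tend to the same finite limit
(`IsAdmissible.exists_isSqueeze`, `IsSqueeze.isAdmissible`): if numbers `p < q` separated all the
`a r` from all the `b r` on a non-meagre set, they would do so on an open set `V`, and both
constants would extend from `V` to elements of every interval.

With this description, two sequences of intervals that keep meeting each other have the same limit,
hence the intervals that span them are admissible (`IsSqueeze.exists_hull`). This gives the
composition axiom and the uniqueness of limits for the order structure, and thence for the initial
and the product structures. Every Hausdorff uniform convergence space has a completion: its points
are the classes of Cauchy filters `F`, `G` with `F × G` in the structure, and its structure is the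
smallest one that contains the given structure and makes each filter converge to its class
(`isCompletion_toCompletion`).

For the uniform continuity of the operator, a filter of the initial structure is split into finitely
many parts, each of which is carried to a single sequence of intervals by every map
`u ↦ 𝒟^α u_i` (`map_mem_orderStructure_of_initial`). The minimum and the maximum of `F_j(x, ·)`
over the box with sides `[a r x, b r x]` depend continuously on the corners, hence converge to the
same limit when the box shrinks to a point; they bound the images of the corresponding `u`
(`exists_isSqueeze_comp`). The extension to the completions is then the universal property of the
first one, applied to the composition of the operator with the embedding into the second one.
-/

namespace OrderCompletion

/-! ### Composition of filters on a square -/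

section Comp

variable {X Y : Type}

lemma mem_compFilter {U V : Filter (X × X)} {W : Set (X × X)} :
    W ∈ compFilter U V ↔ ∃ s ∈ U, ∃ t ∈ V,
      {p : X × X | ∃ z, (p.1, z) ∈ t ∧ (z, p.2) ∈ s} ⊆ W := by
  unfold compFilter
  rw [mem_lift_sets]
  · refine exists_congr fun s => and_congr_right fun _ => ?_
    rw [mem_lift'_sets]
    exact fun t₁ t₂ h p ⟨z, h1, h2⟩ => ⟨z, h h1, h2⟩
  · exact fun s₁ s₂ h => lift'_mono le_rfl fun t p ⟨z, h1, h2⟩ => ⟨z, h1, h h2⟩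

lemma compFilter_mono {U U' V V' : Filter (X × X)} (hU : U ≤ U') (hV : V ≤ V') :
    compFilter U V ≤ compFilter U' V' := fun W hW => by
  obtain ⟨s, hs, t, ht, h⟩ := mem_compFilter.1 hW
  exact mem_compFilter.2 ⟨s, hU hs, t, hV ht, h⟩

lemma compFilter_sup_left (U U' V : Filter (X × X)) :
    compFilter (U ⊔ U') V ≤ compFilter U V ⊔ compFilter U' V := fun W hW => by
  obtain ⟨s, hs, t, ht, h⟩ := mem_compFilter.1 hW.1
  obtain ⟨s', hs', t', ht', h'⟩ := mem_compFilter.1 hW.2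
  refine mem_compFilter.2 ⟨s ∪ s', union_mem_sup hs hs', t ∩ t', inter_mem ht ht', ?_⟩
  rintro p ⟨z, ⟨h1, h2⟩, h3 | h3⟩
  exacts [h ⟨z, h1, h3⟩, h' ⟨z, h2, h3⟩]

lemma compFilter_sup_right (U V V' : Filter (X × X)) :
    compFilter U (V ⊔ V') ≤ compFilter U V ⊔ compFilter U V' := fun W hW => by
  obtain ⟨s, hs, t, ht, h⟩ := mem_compFilter.1 hW.1
  obtain ⟨s', hs', t', ht', h'⟩ := mem_compFilter.1 hW.2
  refine mem_compFilter.2 ⟨s ∩ s', inter_mem hs hs', t ∪ t', union_mem_sup ht ht', ?_⟩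
  rintro p ⟨z, h3 | h3, ⟨h1, h2⟩⟩
  exacts [h ⟨z, h3, h1⟩, h' ⟨z, h3, h2⟩]

lemma map_compFilter_le (f : X → Y) (U V : Filter (X × X)) :
    map (Prod.map f f) (compFilter U V) ≤
      compFilter (map (Prod.map f f) U) (map (Prod.map f f) V) := fun W hW => by
  obtain ⟨s, hs, t, ht, h⟩ := mem_compFilter.1 hW
  exact mem_map.2 (mem_compFilter.2 ⟨_, hs, _, ht, fun p ⟨z, h1, h2⟩ => h ⟨f z, h1, h2⟩⟩)

lemma compFilter_map_le {f : X → Y} (hf : Function.Injective f) (U V : Filter (X × X)) :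
    compFilter (map (Prod.map f f) U) (map (Prod.map f f) V) ≤
      map (Prod.map f f) (compFilter U V) := fun W hW => by
  obtain ⟨s, hs, t, ht, h⟩ := mem_compFilter.1 (mem_map.1 hW)
  refine mem_compFilter.2 ⟨_, image_mem_map hs, _, image_mem_map ht, ?_⟩
  rintro ⟨p, q⟩ ⟨z, ⟨⟨a, b⟩, hab, h1⟩, ⟨⟨c, d⟩, hcd, h2⟩⟩
  simp only [Prod.map_apply, Prod.mk.injEq] at h1 h2
  obtain ⟨rfl, rfl⟩ := h1
  obtain ⟨h2, rfl⟩ := h2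
  obtain rfl := hf h2
  exact h (show (a, d) ∈ _ from ⟨c, hab, hcd⟩)

lemma compFilter_le_map_swap (U V : Filter (X × X)) :
    compFilter U V ≤
      map Prod.swap (compFilter (map Prod.swap V) (map Prod.swap U)) := fun W hW => by
  obtain ⟨s, hs, t, ht, h⟩ := mem_compFilter.1 (mem_map.1 hW)
  exact mem_compFilter.2 ⟨_, ht, _, hs, fun p ⟨z, h1, h2⟩ =>
    h (show (p.2, p.1) ∈ _ from ⟨z, h2, h1⟩)⟩

lemma map_prodMap_swap (f : X → Y) (U : Filter (X × X)) :
    map (Prod.map f f) (map Prod.swap U) = map Prod.swap (map (Prod.map f f) U) := by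
  simp only [map_map]; rfl

lemma map_swap_prod (A B : Filter X) : map Prod.swap (A ×ˢ B) = B ×ˢ A :=
  prod_comm.symm

lemma compFilter_prod_le (A B C D : Filter X) :
    compFilter (A ×ˢ B) (C ×ˢ D) ≤ C ×ˢ B := fun W hW => by
  obtain ⟨c, hc, b, hb, h⟩ := mem_prod_iff.1 hW
  exact mem_compFilter.2 ⟨_, prod_mem_prod univ_mem hb, _, prod_mem_prod hc univ_mem,
    fun p ⟨z, h1, h2⟩ => h ⟨h1.1, h2.2⟩⟩

lemma compFilter_prod_eq_bot {A B C D : Filter X} (h : Disjoint D A) :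
    compFilter (A ×ˢ B) (C ×ˢ D) = ⊥ := by
  obtain ⟨d, hd, a, ha, hda⟩ := Filter.disjoint_iff.1 h
  refine empty_mem_iff_bot.1 (mem_compFilter.2 ⟨_, prod_mem_prod ha univ_mem, _,
    prod_mem_prod univ_mem hd, ?_⟩)
  rintro p ⟨z, h1, h2⟩
  exact (Set.disjoint_left.1 hda h1.2 h2.1).elim

lemma prod_le_compFilter (F G H : Filter X) [hG : G.NeBot] :
    F ×ˢ H ≤ compFilter (G ×ˢ H) (F ×ˢ G) := fun W hW => by
  obtain ⟨s, hs, t, ht, h⟩ := mem_compFilter.1 hW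
  obtain ⟨g, hg, k, hk, hs⟩ := mem_prod_iff.1 hs
  obtain ⟨f, hf, g', hg', ht⟩ := mem_prod_iff.1 ht
  obtain ⟨z, hz⟩ := hG.nonempty_of_mem (inter_mem hg hg')
  exact mem_of_superset (prod_mem_prod hf hk) fun p hp =>
    h ⟨z, ht ⟨hp.1, hz.2⟩, hs ⟨hz.1, hp.2⟩⟩

/-- The image of a filter on `X` under a filter of relations on `X`. -/
def relImage (U : Filter (X × X)) (F : Filter X) : Filter X :=
  map Prod.snd (U ⊓ comap Prod.fst F)

lemma mem_relImage {U : Filter (X × X)} {F : Filter X} {B : Set X} :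
    B ∈ relImage U F ↔ ∃ s ∈ U, ∃ A ∈ F, ∀ x y, (x, y) ∈ s → x ∈ A → y ∈ B := by
  rw [relImage, mem_map, mem_inf_iff_superset]
  constructor
  · rintro ⟨s, hs, t, ⟨A, hA, hAt⟩, h⟩
    exact ⟨s, hs, A, hA, fun x y h1 h2 => h ⟨h1, hAt h2⟩⟩
  · rintro ⟨s, hs, A, hA, h⟩
    exact ⟨s, hs, _, preimage_mem_comap hA, fun p hp => h p.1 p.2 hp.1 hp.2⟩

lemma relImage_bot (U : Filter (X × X)) : relImage U ⊥ = ⊥ := by simp [relImage]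

lemma compFilter_prod_le_relImage (U : Filter (X × X)) (A B : Filter X) :
    compFilter U (A ×ˢ B) ≤ A ×ˢ relImage U B := fun W hW => by
  obtain ⟨a, ha, c, hc, h⟩ := mem_prod_iff.1 hW
  obtain ⟨s, hs, b, hb, hsb⟩ := mem_relImage.1 hc
  exact mem_compFilter.2 ⟨s, hs, _, prod_mem_prod ha hb, fun p ⟨z, h1, h2⟩ =>
    h ⟨h1.1, hsb _ _ h2 h1.2⟩⟩

lemma prod_relImage_le_compFilter (U : Filter (X × X)) (F : Filter X) :
    F ×ˢ relImage U F ≤ compFilter U (F ×ˢ F) := fun W hW => by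
  obtain ⟨s, hs, t, ht, h⟩ := mem_compFilter.1 hW
  obtain ⟨f, hf, g, hg, ht⟩ := mem_prod_iff.1 ht
  have : {y | ∃ z ∈ g, (z, y) ∈ s} ∈ relImage U F :=
    mem_relImage.2 ⟨s, hs, g, hg, fun x y h1 h2 => ⟨x, h2, h1⟩⟩
  exact mem_of_superset (prod_mem_prod hf this) fun p hp => by
    obtain ⟨z, hz, hzs⟩ := hp.2
    exact h ⟨z, ht ⟨hp.1, hz⟩, hzs⟩

end Comp

/-! ### Initial uniform convergence structures -/

section Initial

variable {X ι : Type} {Y : ι → Type} {J : ∀ i, Set (Filter (Y i × Y i))} {f : ∀ i, X → Y i}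

lemma isUniformConvergenceStructure_initial (h : ∀ i, IsUniformConvergenceStructure (J i)) :
    IsUniformConvergenceStructure
      {U : Filter (X × X) | ∀ i, map (Prod.map (f i) (f i)) U ∈ J i} where
  pure_mem x i := by
    have := (h i).pure_mem (f i x)
    simpa only [prod_pure_pure, map_pure, Prod.map_apply] using this
  sup_mem U hU V hV i := by
    rw [map_sup]
    exact (h i).sup_mem _ (hU i) _ (hV i)
  mono U hU V hV i := (h i).mono _ (hU i) _ (map_mono hV)
  swap_mem U hU i := by
    rw [map_prodMap_swap]
    exact (h i).swap_mem _ (hU i)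
  comp_mem U hU V hV i :=
    (h i).mono _ ((h i).comp_mem _ (hU i) _ (hV i)) _ (map_compFilter_le _ _ _)

lemma isHausdorff_initial (h : ∀ i, IsHausdorff (J i))
    (hf : ∀ x y, (∀ i, f i x = f i y) → x = y) :
    IsHausdorff {U : Filter (X × X) | ∀ i, map (Prod.map (f i) (f i)) U ∈ J i} := by
  intro F x y hF hx hy
  have key : ∀ {z} i, ConvergesTo {U : Filter (X × X) | ∀ i, map (Prod.map (f i) (f i)) U ∈ J i}
      F z → ConvergesTo (J i) (map (f i) F) (f i z) := fun {z} i hz => by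
    have := hz i
    rwa [← prod_map_map_eq', map_pure] at this
  exact hf x y fun i => h i _ _ _ (hF.map _) (key i hx) (key i hy)

end Initial

/-! ### The completion of a Hausdorff uniform convergence space -/

section Completion

variable {X : Type} {J : Set (Filter (X × X))}

lemma IsUniformConvergenceStructure.prod_swap (h : IsUniformConvergenceStructure J)
    {F G : Filter X} (hFG : F ×ˢ G ∈ J) : G ×ˢ F ∈ J := by
  rw [← map_swap_prod]
  exact h.swap_mem _ hFG

lemma IsUniformConvergenceStructure.prod_trans (h : IsUniformConvergenceStructure J)
    {F G H : Filter X} [G.NeBot] (hFG : F ×ˢ G ∈ J) (hGH : G ×ˢ H ∈ J) : F ×ˢ H ∈ J :=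
  h.mono _ (h.comp_mem _ hGH _ hFG) _ (prod_le_compFilter F G H)

lemma IsUniformConvergenceStructure.isCauchy_pure (h : IsUniformConvergenceStructure J) (x : X) :
    IsCauchy J (pure x) := ⟨inferInstance, h.pure_mem x⟩

/-- Cauchy filters `F`, `G` are equivalent if `F × G` belongs to the structure. -/
def cauchySetoid (h : IsUniformConvergenceStructure J) : Setoid {F : Filter X // IsCauchy J F} where
  r F G := F.1 ×ˢ G.1 ∈ J
  iseqv :=
    { refl := fun F => F.2.2
      symm := fun hFG => h.prod_swap hFG
      trans := fun {_ G _} hFG hGH => haveI := G.2.1; h.prod_trans hFG hGH }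

/-- The points of the completion: equivalence classes of Cauchy filters. -/
def Completion (h : IsUniformConvergenceStructure J) : Type := Quotient (cauchySetoid h)

/-- The canonical map into the completion sends `x` to the class of the filters converging
to `x`. -/
def toCompletion (h : IsUniformConvergenceStructure J) (x : X) : Completion h :=
  Quotient.mk (cauchySetoid h) ⟨pure x, h.isCauchy_pure x⟩

/-- The filter `F` is improper or a Cauchy filter of the class `p`. -/
def Belongs (h : IsUniformConvergenceStructure J) (F : Filter X) (p : Completion h) : Prop :=
  F ×ˢ (Quotient.out p).1 ∈ J

variable {h : IsUniformConvergenceStructure J} {F G : Filter X} {p q : Completion h}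

lemma neBot_out (p : Completion h) : (Quotient.out p).1.NeBot := (Quotient.out p).2.1

lemma belongs_mk (F : Filter X) (G : {F : Filter X // IsCauchy J F}) :
    Belongs h F (Quotient.mk (cauchySetoid h) G) ↔ F ×ˢ G.1 ∈ J := by
  have := neBot_out (Quotient.mk (cauchySetoid h) G)
  have hG := G.2.1
  have e : (Quotient.out (Quotient.mk (cauchySetoid h) G)).1 ×ˢ G.1 ∈ J :=
    Quotient.mk_out (s := cauchySetoid h) G
  exact ⟨fun hF => h.prod_trans hF e, fun hF => h.prod_trans hF (h.prod_swap e)⟩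

lemma belongs_toCompletion {x : X} : Belongs h F (toCompletion h x) ↔ F ×ˢ pure x ∈ J :=
  belongs_mk F _

lemma belongs_out (p : Completion h) : Belongs h (Quotient.out p).1 p := (Quotient.out p).2.2

lemma Belongs.mono (hF : Belongs h F p) (hG : G ≤ F) : Belongs h G p :=
  h.mono _ hF _ (prod_mono_left _ hG)

lemma Belongs.sup (hF : Belongs h F p) (hG : Belongs h G p) : Belongs h (F ⊔ G) p := by
  unfold Belongs
  rw [sup_prod]
  exact h.sup_mem _ hF _ hG

lemma Belongs.prod_mem (hF : Belongs h F p) (hG : Belongs h G p) : F ×ˢ G ∈ J :=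
  haveI := neBot_out p
  h.prod_trans hF (h.prod_swap hG)

/-- A proper filter belongs to at most one class. -/
lemma Belongs.eq [F.NeBot] (hp : Belongs h F p) (hq : Belongs h F q) : p = q := by
  rw [← Quotient.out_eq p, ← Quotient.out_eq q]
  exact Quotient.sound (s := cauchySetoid h) (h.prod_trans (h.prod_swap hp) hq)

lemma belongs_bot (p : Completion h) : Belongs h ⊥ p := (belongs_out p).mono bot_le

lemma Belongs.relImage {U : Filter (X × X)} (hU : U ∈ J) (hF : Belongs h F p) :
    Belongs h (relImage U F) p := by
  rcases F.eq_or_neBot with rfl | hne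
  · rw [relImage_bot]
    exact belongs_bot p
  · exact h.prod_trans (h.prod_swap (h.mono _ (h.comp_mem _ hU _ (hF.prod_mem hF)) _
      (prod_relImage_le_compFilter U F))) hF

lemma toCompletion_injective (hH : IsHausdorff J) : Function.Injective (toCompletion h) :=
  fun x y hxy => hH (pure x) x y inferInstance (h.pure_mem x) <| by
    have : Belongs h (pure x) (toCompletion h x) := belongs_toCompletion.2 (h.pure_mem x)
    rw [hxy] at this
    exact belongs_toCompletion.1 this

/-- The image of `F` in the completion together with the point `p`; for `F` of the class `p`, this
filter is to converge to `p`. -/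
def cluster (F : Filter X) (p : Completion h) : Filter (Completion h) :=
  map (toCompletion h) F ⊔ pure p

/-- The structure of the completion: the smallest family, closed under finite intersections and
finer filters, that contains the images of the filters of `J` and makes the filters of the class
`p` converge to `p`, for each new point `p`. -/
inductive completionStructure (h : IsUniformConvergenceStructure J) :
    Set (Filter (Completion h × Completion h))
  | image (U : Filter (X × X)) (hU : U ∈ J) :
      completionStructure h (map (Prod.map (toCompletion h) (toCompletion h)) U)
  | cluster (F : Filter X) (p : Completion h) (hF : Belongs h F p)
      (hp : p ∉ Set.range (toCompletion h)) :
      completionStructure h (cluster F p ×ˢ cluster F p)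
  | sup (U V : Filter (Completion h × Completion h)) (hU : completionStructure h U)
      (hV : completionStructure h V) : completionStructure h (U ⊔ V)
  | mono (U V : Filter (Completion h × Completion h)) (hU : completionStructure h U)
      (hV : V ≤ U) : completionStructure h V

lemma cluster_mono (hFG : F ≤ G) : cluster F p ≤ cluster G p := sup_le_sup_right (map_mono hFG) _

lemma swap_mem_completionStructure {W : Filter (Completion h × Completion h)}
    (hW : W ∈ completionStructure h) : map Prod.swap W ∈ completionStructure h := by
  induction hW with
  | image U hU =>
    rw [← map_prodMap_swap]
    exact .image _ (h.swap_mem _ hU)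
  | cluster F p hF hp =>
    rw [map_swap_prod]
    exact .cluster F p hF hp
  | sup U V _ _ h1 h2 =>
    rw [map_sup]
    exact .sup _ _ h1 h2
  | mono U V _ hV h1 => exact .mono _ _ h1 (map_mono hV)

/-- Relations between old points do not see the new point `p`. -/
lemma relImage_cluster_le (hH : IsHausdorff J) (U : Filter (X × X))
    (hp : p ∉ Set.range (toCompletion h)) :
    relImage (map (Prod.map (toCompletion h) (toCompletion h)) U) (cluster F p) ≤
      map (toCompletion h) (relImage U F) := fun B hB => by
  obtain ⟨s, hs, A, hA, hsA⟩ := mem_relImage.1 (mem_map.1 hB)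
  refine mem_relImage.2 ⟨_, image_mem_map hs, _,
    union_mem_sup (image_mem_map hA) (mem_pure.2 (Set.mem_singleton p)), ?_⟩
  rintro _ _ ⟨⟨a, b⟩, hab, hxy⟩ hx
  obtain ⟨rfl, rfl⟩ := Prod.ext_iff.1 hxy
  rcases hx with ⟨a', ha', hx⟩ | hx
  · obtain rfl := toCompletion_injective hH hx
    exact hsA _ _ hab ha'
  · exact (hp ⟨a, hx⟩).elim

lemma comp_image_cluster_mem (hH : IsHausdorff J) {U : Filter (X × X)} (hU : U ∈ J)
    (hF : Belongs h F p) (hp : p ∉ Set.range (toCompletion h)) :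
    compFilter (map (Prod.map (toCompletion h) (toCompletion h)) U) (cluster F p ×ˢ cluster F p) ∈
      completionStructure h := by
  refine .mono _ _ (.cluster (F ⊔ relImage U F) p (hF.sup (hF.relImage hU)) hp) ?_
  refine (compFilter_prod_le_relImage _ _ _).trans (prod_mono (cluster_mono le_sup_left) ?_)
  exact ((relImage_cluster_le hH U hp).trans (map_mono le_sup_right)).trans le_sup_left

lemma disjoint_cluster (hH : IsHausdorff J) (hF : Belongs h F p) (hG : Belongs h G q)
    (hp : p ∉ Set.range (toCompletion h)) (hq : q ∉ Set.range (toCompletion h)) (hpq : p ≠ q) :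
    Disjoint (cluster F p) (cluster G q) := by
  have hFG : Disjoint F G := by
    rw [disjoint_iff]
    by_contra hne
    have : (F ⊓ G).NeBot := ⟨hne⟩
    exact hpq ((hF.mono inf_le_left).eq (hG.mono inf_le_right))
  obtain ⟨A, hA, B, hB, hAB⟩ := Filter.disjoint_iff.1 hFG
  refine Filter.disjoint_iff.2 ⟨_, union_mem_sup (image_mem_map hA)
    (mem_pure.2 (Set.mem_singleton p)), _, union_mem_sup (image_mem_map hB)
    (mem_pure.2 (Set.mem_singleton q)), Set.disjoint_left.2 ?_⟩
  rintro _ (⟨a, ha, rfl⟩ | hz) (⟨b, hb, hab⟩ | hz')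
  · rw [toCompletion_injective hH hab] at hb
    exact Set.disjoint_left.1 hAB ha hb
  · exact hq ⟨a, hz'⟩
  · exact hp ⟨b, hab.trans hz⟩
  · exact hpq (hz.symm.trans hz')

lemma comp_mem_completionStructure (hH : IsHausdorff J)
    {U V : Filter (Completion h × Completion h)} (hU : U ∈ completionStructure h)
    (hV : V ∈ completionStructure h) : compFilter U V ∈ completionStructure h := by
  induction hU with
  | image U hU =>
    induction hV with
    | image V hV =>
      exact .mono _ _ (.image _ (h.comp_mem _ hU _ hV))
        (compFilter_map_le (toCompletion_injective hH) _ _)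
    | cluster F p hF hp => exact comp_image_cluster_mem hH hU hF hp
    | sup V V' _ _ h1 h2 => exact .mono _ _ (.sup _ _ h1 h2) (compFilter_sup_right _ _ _)
    | mono V V' _ hV h1 => exact .mono _ _ h1 (compFilter_mono le_rfl hV)
  | cluster F p hF hp =>
    induction hV with
    | image V hV =>
      refine .mono _ _ (swap_mem_completionStructure ?_) (compFilter_le_map_swap _ _)
      rw [map_swap_prod, ← map_prodMap_swap]
      exact comp_image_cluster_mem hH (h.swap_mem _ hV) hF hp
    | cluster G q hG hq =>
      by_cases hpq : p = q
      · subst hpq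
        exact .mono _ _ (.cluster (F ⊔ G) p (hF.sup hG) hp)
          ((compFilter_prod_le _ _ _ _).trans
            (prod_mono (cluster_mono le_sup_right) (cluster_mono le_sup_left)))
      · rw [compFilter_prod_eq_bot (disjoint_cluster hH hG hF hq hp (Ne.symm hpq))]
        exact .mono _ _ (.cluster F p hF hp) bot_le
    | sup V V' _ _ h1 h2 => exact .mono _ _ (.sup _ _ h1 h2) (compFilter_sup_right _ _ _)
    | mono V V' _ hV h1 => exact .mono _ _ h1 (compFilter_mono le_rfl hV)
  | sup U U' _ _ h1 h2 => exact .mono _ _ (.sup _ _ h1 h2) (compFilter_sup_left _ _ _)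
  | mono U U' _ hU h1 => exact .mono _ _ h1 (compFilter_mono hU le_rfl)

/-- The filters of the class `p` converge to `p`, for new and for old points `p`. -/
lemma convergesTo_of_belongs (hF : Belongs h F p) :
    ConvergesTo (completionStructure h) (map (toCompletion h) F) p := by
  by_cases hp : p ∈ Set.range (toCompletion h)
  · obtain ⟨x, rfl⟩ := hp
    have := completionStructure.image (h := h) _ (belongs_toCompletion.1 hF)
    rwa [← prod_map_map_eq', map_pure] at this
  · exact .mono _ _ (.cluster F p hF hp) (prod_mono le_sup_left le_sup_right)

lemma pure_mem_completionStructure (p : Completion h) :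
    (pure p ×ˢ pure p : Filter (Completion h × Completion h)) ∈ completionStructure h := by
  by_cases hp : p ∈ Set.range (toCompletion h)
  · obtain ⟨x, rfl⟩ := hp
    have := completionStructure.image (h := h) _ (h.pure_mem x)
    rwa [← prod_map_map_eq', map_pure] at this
  · exact .mono _ _ (.cluster _ p (belongs_out p) hp) (prod_mono le_sup_right le_sup_right)

lemma isUniformConvergenceStructure_completion (hH : IsHausdorff J) :
    IsUniformConvergenceStructure (completionStructure h) where
  pure_mem := pure_mem_completionStructure
  sup_mem U hU V hV := .sup U V hU hV
  mono U hU V hV := .mono U V hU hV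
  swap_mem _ := swap_mem_completionStructure
  comp_mem _ hU _ hV := comp_mem_completionStructure hH hU hV

lemma comap_cluster (hH : IsHausdorff J) (F : Filter X) (hp : p ∉ Set.range (toCompletion h)) :
    comap (toCompletion h) (cluster F p) = F := by
  rw [cluster, comap_sup, comap_map (toCompletion_injective hH), sup_eq_left]
  have : comap (toCompletion h) (pure p) = ⊥ := by
    refine empty_mem_iff_bot.1 ⟨{p}, mem_pure.2 rfl, fun x hx => hp ⟨x, hx⟩⟩
  rw [this]
  exact bot_le

/-- Pulling a filter of the completion structure back to `X × X` gives a filter of `J`. -/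
lemma comap_prodMap_mem (hH : IsHausdorff J) {W : Filter (Completion h × Completion h)}
    (hW : W ∈ completionStructure h) :
    comap (Prod.map (toCompletion h) (toCompletion h)) W ∈ J := by
  induction hW with
  | image U hU =>
    rwa [comap_map ((toCompletion_injective hH).prodMap (toCompletion_injective hH))]
  | cluster F p hF hp =>
    have := prod_comap_comap_eq (f₁ := cluster F p) (f₂ := cluster F p)
      (m₁ := toCompletion h) (m₂ := toCompletion h)
    rw [comap_cluster hH F hp] at this
    exact this ▸ hF.prod_mem hF
  | sup U V _ _ h1 h2 =>
    rw [comap_sup]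
    exact h.sup_mem _ h1 _ h2
  | mono U V _ hV h1 => exact h.mono _ h1 _ (comap_mono hV)

/-- The slice of a filter of the completion structure at a new point `p` belongs to `p`. -/
lemma belongs_comap (hH : IsHausdorff J) {W : Filter (Completion h × Completion h)}
    (hW : W ∈ completionStructure h) (hp : p ∉ Set.range (toCompletion h)) :
    Belongs h (comap (fun x => (toCompletion h x, p)) W) p := by
  induction hW with
  | image U hU =>
    refine (belongs_bot p).mono (empty_mem_iff_bot.1
      (mem_comap.2 ⟨_, image_mem_map univ_mem, ?_⟩)).le
    rintro x ⟨⟨a, b⟩, -, hab⟩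
    exact hp ⟨b, (Prod.ext_iff.1 hab).2⟩
  | cluster F q hF hq =>
    by_cases hpq : p = q
    · subst hpq
      refine hF.mono ?_
      conv_rhs => rw [← comap_cluster hH F hp]
      rintro A ⟨B, hB, hBA⟩
      exact ⟨B ×ˢ Set.univ, prod_mem_prod hB univ_mem, fun x hx => hBA hx.1⟩
    · have h1 : ({p}ᶜ : Set (Completion h)) ∈ cluster F q :=
        ⟨mem_map.2 (mem_of_superset univ_mem fun x _ hx => hp ⟨x, hx⟩),
          mem_pure.2 fun hx => hpq hx.symm⟩
      refine (belongs_bot p).mono (empty_mem_iff_bot.1 (mem_comap.2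
        ⟨_, prod_mem_prod univ_mem h1, ?_⟩)).le
      exact fun x hx => hx.2 rfl
  | sup U V _ _ h1 h2 =>
    rw [comap_sup]
    exact h1.sup h2
  | mono U V _ hV h1 => exact h1.mono (comap_mono hV)

/-- Off the image of `X`, a filter of the completion structure is carried by the diagonal. -/
lemma diagonal_mem_completionStructure {W : Filter (Completion h × Completion h)}
    (hW : W ∈ completionStructure h) :
    {x : Completion h × Completion h | x.1 ∉ Set.range (toCompletion h) →
      x.2 ∉ Set.range (toCompletion h) → x.1 = x.2} ∈ W := by
  induction hW with
  | image U hU => exact mem_map.2 (mem_of_superset univ_mem fun x _ hx => (hx ⟨x.1, rfl⟩).elim)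
  | cluster F p hF hp =>
    have : Set.range (toCompletion h) ∪ {p} ∈ cluster F p :=
      union_mem_sup range_mem_map (mem_pure.2 rfl)
    refine mem_of_superset (prod_mem_prod this this) fun x hx h1 h2 => ?_
    exact (hx.1.resolve_left h1).trans (hx.2.resolve_left h2).symm
  | sup U V _ _ h1 h2 => exact ⟨h1, h2⟩
  | mono U V _ hV h1 => exact hV h1

/-- A filter of the completion structure involves only finitely many new points. -/
lemma exists_finite_mem_completionStructure {W : Filter (Completion h × Completion h)}
    (hW : W ∈ completionStructure h) :
    ∃ P : Set (Completion h), P.Finite ∧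
      {x : Completion h × Completion h | x.1 ∈ Set.range (toCompletion h) ∪ P} ∈ W := by
  induction hW with
  | image U hU =>
    exact ⟨∅, Set.finite_empty, mem_map.2 (mem_of_superset univ_mem fun x _ => .inl ⟨x.1, rfl⟩)⟩
  | cluster F p hF hp =>
    have : Set.range (toCompletion h) ∪ {p} ∈ cluster F p :=
      union_mem_sup range_mem_map (mem_pure.2 rfl)
    exact ⟨{p}, Set.finite_singleton p,
      mem_of_superset (prod_mem_prod this univ_mem) fun x hx => hx.1⟩
  | sup U V _ _ h1 h2 =>
    obtain ⟨P, hP, h1⟩ := h1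
    obtain ⟨Q, hQ, h2⟩ := h2
    exact ⟨P ∪ Q, hP.union hQ,
      mem_of_superset h1 fun x hx => Set.union_subset_union_right _ Set.subset_union_left hx,
      mem_of_superset h2 fun x hx => Set.union_subset_union_right _ Set.subset_union_right hx⟩
  | mono U V _ hV h1 => exact h1.imp fun P hP => ⟨hP.1, hV hP.2⟩

/-- Points that the completion structure does not separate are equal. -/
lemma eq_of_pure_prod_mem (hH : IsHausdorff J)
    (hpq : (pure p ×ˢ pure q : Filter (Completion h × Completion h)) ∈ completionStructure h) :
    p = q := by
  have key : ∀ {x : X} {r : Completion h},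
      (pure (toCompletion h x) ×ˢ pure r : Filter (Completion h × Completion h)) ∈
        completionStructure h → toCompletion h x = r := fun {x r} hxr => by
    by_cases hr : r ∈ Set.range (toCompletion h)
    · obtain ⟨y, rfl⟩ := hr
      have := comap_prodMap_mem hH hxr
      rw [prod_pure_pure, ← Prod.map_apply, ← Filter.map_pure,
        comap_map ((toCompletion_injective hH).prodMap (toCompletion_injective hH)),
        ← prod_pure_pure] at this
      rw [hH (pure x) x y inferInstance (h.pure_mem x) this]
    · have h1 : Belongs h (pure x) r := (belongs_comap hH hxr hr).mono <| by
        rw [← map_le_iff_le_comap, Filter.map_pure, prod_pure_pure]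
      exact (belongs_toCompletion.2 (h.pure_mem x)).eq h1
  by_cases hp : p ∈ Set.range (toCompletion h)
  · obtain ⟨x, rfl⟩ := hp
    exact key hpq
  by_cases hq : q ∈ Set.range (toCompletion h)
  · obtain ⟨y, rfl⟩ := hq
    have := swap_mem_completionStructure hpq
    rw [map_swap_prod] at this
    exact (key this).symm
  · have := diagonal_mem_completionStructure hpq
    rw [prod_pure_pure] at this
    exact mem_pure.1 this hp hq

lemma isHausdorff_completion (hH : IsHausdorff J) : IsHausdorff (completionStructure h) :=
  fun _ _ _ _ hp hq =>
    have hU := isUniformConvergenceStructure_completion (h := h) hH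
    eq_of_pure_prod_mem hH (hU.prod_trans (hU.prod_swap hp) hq)

lemma isCompleteUCS_completion (hH : IsHausdorff J) :
    IsCompleteUCS (completionStructure h) := by
  rintro G ⟨hG, hGG⟩
  -- The trace of `G` on `X` is a Cauchy filter as soon as it is proper.
  have hCauchy : comap (toCompletion h) G ×ˢ comap (toCompletion h) G ∈ J := by
    rw [prod_comap_comap_eq]
    exact comap_prodMap_mem hH hGG
  have hle : ∀ Q : Set (Completion h), Set.range (toCompletion h) ∪ Q ∈ G →
      G ≤ map (toCompletion h) (comap (toCompletion h) G) ⊔ 𝓟 Q := fun Q hQ B hB => by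
    obtain ⟨⟨A, hA, hAB⟩, hQB⟩ := hB
    filter_upwards [hA, hQ] with x hx hx'
    rcases hx' with ⟨y, rfl⟩ | hx'
    · exact hAB hx
    · exact hQB hx'
  obtain ⟨P, hP, hPG⟩ := exists_finite_mem_completionStructure hGG
  replace hPG : Set.range (toCompletion h) ∪ P ∈ G := by
    have h1 : map Prod.fst (G ×ˢ G) = G := map_fst_prod G G
    rw [← h1]
    exact hPG
  by_cases hnew : ∃ p ∉ Set.range (toCompletion h), pure p ≤ G
  · -- If `G` clusters at the new point `p`, it meets no other new point, so it converges to `p`.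
    obtain ⟨p, hp, hpG⟩ := hnew
    have h1 : Set.range (toCompletion h) ∪ {p} ∈ G := by
      have h2 : ∀ᶠ x in G, x ∉ Set.range (toCompletion h) → p ∉ Set.range (toCompletion h) →
          x = p := by
        have := diagonal_mem_completionStructure
          (h := h) (.mono _ _ hGG (prod_mono_right G hpG))
        rw [prod_pure] at this
        exact mem_map.1 this
      filter_upwards [h2] with x hx
      by_cases hxr : x ∈ Set.range (toCompletion h)
      exacts [.inl hxr, .inr (hx hxr hp)]
    have h2 : Belongs h (comap (toCompletion h) G) p := by
      refine (belongs_comap hH (.mono _ _ hGG (prod_mono_right G hpG)) hp).mono ?_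
      rw [prod_pure, ← map_le_iff_le_comap]
      have : (fun x => (toCompletion h x, p)) = (fun a => (a, p)) ∘ toCompletion h := rfl
      rw [this, ← map_map]
      exact map_mono map_comap_le
    refine ⟨p, .mono _ _ (.cluster _ p h2 hp) (prod_mono ?_ le_sup_right)⟩
    exact (hle _ h1).trans (by rw [principal_singleton]; exact le_rfl)
  · -- Otherwise the finitely many new points can be removed, and `G` comes from a filter on `X`.
    push Not at hnew
    have h1 : Set.range (toCompletion h) ∪ ∅ ∈ G := by
      have h2 : ∀ p ∈ P, ∀ᶠ x in G, x = p → p ∈ Set.range (toCompletion h) := fun p _ => by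
        by_cases hp : p ∈ Set.range (toCompletion h)
        · exact .of_forall fun _ _ => hp
        · have h3 := hnew p hp
          rw [pure_le_iff] at h3
          push Not at h3
          obtain ⟨s, hs, hps⟩ := h3
          filter_upwards [hs] with x hx hxp
          exact (hps (hxp ▸ hx)).elim
      filter_upwards [hPG, (hP.eventually_all).2 h2] with x hx hx'
      exact .inl (hx.elim id fun hxP => (hx' x hxP rfl))
    have h2 := hle _ h1
    rw [principal_empty, sup_bot_eq] at h2
    have h3 : (comap (toCompletion h) G).NeBot := map_neBot_iff _ |>.1 (hG.mono h2)
    refine ⟨Quotient.mk (cauchySetoid h) ⟨_, h3, hCauchy⟩, ?_⟩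
    exact .mono _ _ (convergesTo_of_belongs ((belongs_mk _ _).2 hCauchy)) (prod_mono_left _ h2)

/-- A Hausdorff uniform convergence space has a completion. -/
lemma isCompletion_toCompletion (h : IsUniformConvergenceStructure J) (hH : IsHausdorff J) :
    IsCompletion J (completionStructure h) (toCompletion h) where
  isUCS := isUniformConvergenceStructure_completion hH
  hausdorff := isHausdorff_completion hH
  complete := isCompleteUCS_completion hH
  injective := toCompletion_injective hH
  embedding U := by
    refine ⟨fun hU => .image U hU, fun hU => ?_⟩
    have := comap_prodMap_mem hH hU
    rwa [comap_map ((toCompletion_injective hH).prodMap (toCompletion_injective hH))] at this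
  dense p := ⟨_, neBot_out p, convergesTo_of_belongs (belongs_out p)⟩
  extend Z JZ hZ hZH hZC f hf := by
    -- The extension sends the class of `F` to the limit of the image of `F`.
    have hlim : ∀ p : Completion h, ∃ z, ConvergesTo JZ (map f (Quotient.out p).1) z := fun p => by
      refine hZC _ ⟨(neBot_out p).map f, ?_⟩
      rw [prod_map_map_eq']
      exact hf _ (belongs_out p)
    choose g hg using hlim
    have hgF : ∀ (F : Filter X) (p : Completion h), Belongs h F p →
        ConvergesTo JZ (map f F) (g p) := fun F p hF => by
      have h1 := hf _ hF
      rw [← prod_map_map_eq'] at h1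
      have := (neBot_out p).map f
      exact hZ.prod_trans h1 (hg p)
    have hge : ∀ x, g (toCompletion h x) = f x := fun x => by
      have h1 := hgF (pure x) _ (belongs_toCompletion.2 (h.pure_mem x))
      rw [map_pure] at h1
      exact hZH _ _ _ inferInstance h1 (hZ.pure_mem _)
    refine ⟨g, ⟨fun W hW => ?_, funext hge⟩, fun g' hg' => funext fun p => ?_⟩
    · have hcomp : g ∘ toCompletion h = f := funext hge
      induction hW with
      | image U hU =>
        rw [map_map, Prod.map_comp_map, hcomp]
        exact hf U hU
      | cluster F p hF hp =>
        rw [← prod_map_map_eq', cluster, map_sup, map_map, hcomp, map_pure, sup_prod, prod_sup,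
          prod_sup]
        have h1 := hgF F p hF
        have h2 := hf _ (hF.prod_mem hF)
        rw [← prod_map_map_eq'] at h2
        exact hZ.sup_mem _ (hZ.sup_mem _ h2 _ h1) _
          (hZ.sup_mem _ (hZ.prod_swap h1) _ (hZ.pure_mem _))
      | sup U V _ _ h1 h2 =>
        rw [map_sup]
        exact hZ.sup_mem _ h1 _ h2
      | mono U V _ hV h1 => exact hZ.mono _ h1 _ (map_mono hV)
    · have h1 := hg'.1 _ (convergesTo_of_belongs (belongs_out p))
      rw [← prod_map_map_eq', map_map, hg'.2, map_pure] at h1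
      exact hZH _ _ _ ((neBot_out p).map f) h1 (hg p)

end Completion

/-! ### Baire operators and nearly finite functions -/

section Baire

variable {X : Type} [PseudoMetricSpace X]

lemma upperBaire_eq_limsup (u : X → EReal) (x : X) : upperBaire u x = limsup u (𝓝 x) :=
  (Metric.nhds_basis_ball.limsup_eq_iInf_iSup).symm

lemma lowerBaire_eq_liminf (u : X → EReal) (x : X) : lowerBaire u x = liminf u (𝓝 x) :=
  (Metric.nhds_basis_ball.liminf_eq_iSup_iInf).symm

/-- On an open set `V`, an inequality between `u` and `v` on a dense open part of `V` passes to
`(I ∘ S) u` and `(I ∘ S) v`. -/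
lemma baireIS_le_baireIS {u v : X → EReal} {V D : Set X} (hV : IsOpen V) (hD : IsOpen D)
    (hDd : Dense D) (huv : ∀ y ∈ V, y ∈ D → u y ≤ v y) {x : X} (hx : x ∈ V) :
    baireIS u x ≤ baireIS v x := by
  have hS : ∀ y ∈ V, y ∈ D → upperBaire u y ≤ upperBaire v y := fun y hyV hyD => by
    rw [upperBaire_eq_limsup, upperBaire_eq_limsup]
    refine limsup_le_limsup ?_
    filter_upwards [hV.mem_nhds hyV, hD.mem_nhds hyD] with z hzV hzD using huv z hzV hzD
  refine le_of_forall_lt_imp_le_of_dense fun c hc => ?_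
  rw [baireIS, lowerBaire_eq_liminf] at hc ⊢
  refine le_liminf_of_le (by isBoundedDefault) ?_
  filter_upwards [(eventually_lt_of_lt_liminf hc).eventually_nhds, hV.mem_nhds hx] with y hy hyV
  -- `S v` is upper semi-continuous, so its bounds on `D` near `y` hold at `y` as well.
  rw [← upperBaire_idem, upperBaire_eq_limsup]
  refine le_limsup_of_frequently_le' ?_
  refine ((mem_closure_iff_frequently.1 (hDd y)).and_eventually
    (hy.and (hV.mem_nhds hyV))).mono ?_
  rintro z ⟨hzD, hcz, hzV⟩
  exact hcz.le.trans (hS z hzV hzD)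

lemma baireIS_comp {Y : Type} [PseudoMetricSpace Y] {f : Y → X} (hf : IsOpenEmbedding f)
    (u : X → EReal) : baireIS (u ∘ f) = baireIS u ∘ f := by
  have h1 : upperBaire (u ∘ f) = upperBaire u ∘ f := funext fun y => by
    rw [upperBaire_eq_limsup, limsup_comp, hf.map_nhds_eq, Function.comp_apply,
      upperBaire_eq_limsup]
  funext y
  rw [baireIS, h1, lowerBaire_eq_liminf, liminf_comp, hf.map_nhds_eq, Function.comp_apply, baireIS,
    lowerBaire_eq_liminf]

end Baire

section ML

variable {n : ℕ} {Ω : Opens (E n)}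

instance : BaireSpace Ω :=
  have : LocallyCompactSpace Ω := Ω.isOpen.locallyCompactSpace
  inferInstance

/-- A nearly finite function is of class `C^0` if and only if it is finite and continuous on a
dense open set. -/
lemma isML_zero_iff {u : Ω → EReal} :
    IsML 0 u ↔ baireIS u = u ∧ ∃ D : Set Ω, IsOpen D ∧ Dense D ∧ (∀ x ∈ D, u x ≠ ⊤ ∧ u x ≠ ⊥) ∧
      ContinuousOn (fun x => (u x).toReal) D := by
  have hi : IsInducing (Subtype.val : Ω → E n) := IsInducing.subtypeVal
  have he : realPart u ∘ Subtype.val = fun x => (u x).toReal := funext fun x => realPart_val u x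
  constructor
  · rintro ⟨⟨h1, -⟩, Γ, hΓ, hΓ', h2, h3⟩
    obtain ⟨hO, hD⟩ := isClosed_isNowhereDense_iff_compl.1 ⟨hΓ, hΓ'⟩
    rw [Nat.cast_zero, contDiffOn_zero, hi.continuousOn_image_iff, he] at h3
    exact ⟨h1, Γᶜ, hO, hD, h2, h3⟩
  · rintro ⟨h1, D, hO, hD, h2, h3⟩
    obtain ⟨hΓ, hΓ'⟩ := isClosed_isNowhereDense_iff_compl (s := Dᶜ).2 (by simpa using ⟨hO, hD⟩)
    refine ⟨⟨h1, D, hO, hD, h2⟩, Dᶜ, hΓ, hΓ', fun x hx => h2 x (not_not.1 hx), ?_⟩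
    rw [Nat.cast_zero, contDiffOn_zero, hi.continuousOn_image_iff, he, compl_compl]
    exact h3

lemma ML.exists_continuousOn (u : ML Ω 0) :
    ∃ D : Set Ω, IsOpen D ∧ Dense D ∧ (∀ x ∈ D, ((u.1 x).toReal : EReal) = u.1 x) ∧
      ContinuousOn (fun x => (u.1 x).toReal) D := by
  obtain ⟨-, D, h1, h2, h3, h4⟩ := isML_zero_iff.1 u.2
  exact ⟨D, h1, h2, fun x hx => EReal.coe_toReal (h3 x hx).1 (h3 x hx).2, h4⟩

lemma ML.eventually_coe_toReal (u : ML Ω 0) :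
    ∀ᶠ x in residual Ω, ((u.1 x).toReal : EReal) = u.1 x := by
  obtain ⟨D, h1, h2, h3, -⟩ := u.exists_continuousOn
  exact mem_of_superset (residual_of_dense_open h1 h2) h3

/-- Elements of `ML^0(Ω)` are compared on an open set by comparing them at the points of a
residual subset of it. -/
lemma ML.le_of_residual {u v : ML Ω 0} {V : Set Ω} (hV : IsOpen V)
    (huv : ∀ᶠ x in residual Ω, x ∈ V → u.1 x ≤ v.1 x) {x : Ω} (hx : x ∈ V) : u.1 x ≤ v.1 x := by
  obtain ⟨D, hDo, hD, hu, huc⟩ := u.exists_continuousOn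
  obtain ⟨D', hDo', hD', hv, hvc⟩ := v.exists_continuousOn
  rw [← (isML_zero_iff.1 u.2).1, ← (isML_zero_iff.1 v.2).1]
  refine baireIS_le_baireIS hV (hDo.inter hDo') (hD.inter_of_isOpen_left hD' hDo) ?_ hx
  rintro y hyV ⟨hyD, hyD'⟩
  rw [← hu y hyD, ← hv y hyD', EReal.coe_le_coe_iff]
  -- Both sides are continuous at `y`, which is a limit of points of the residual set.
  by_contra! hlt
  have h1 : ∀ᶠ z in 𝓝 y, (v.1 z).toReal < (u.1 z).toReal :=
    (hvc.continuousAt (hDo'.mem_nhds hyD')).eventually_lt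
      (huc.continuousAt (hDo.mem_nhds hyD)) hlt
  have h2 : ∀ᶠ z in 𝓝 y, z ∈ V ∩ (D ∩ D') :=
    (hV.inter (hDo.inter hDo')).mem_nhds ⟨hyV, hyD, hyD'⟩
  obtain ⟨z, hz, hzlt, hzV, hzD, hzD'⟩ := ((mem_closure_iff_frequently.1
    (dense_of_mem_residual huv y)).and_eventually (h1.and h2)).exists
  have hle := hz hzV
  rw [← hu z hzD, ← hv z hzD', EReal.coe_le_coe_iff] at hle
  exact hle.not_gt hzlt

lemma ML.le_iff_residual {u v : ML Ω 0} : u ≤ v ↔ ∀ᶠ x in residual Ω, u.1 x ≤ v.1 x :=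
  ⟨fun h => .of_forall h, fun h x =>
    ML.le_of_residual isOpen_univ (h.mono fun _ hx _ => hx) (Set.mem_univ x)⟩

/-- A real function that is continuous on a dense open set is represented there by an element of
`ML^0(Ω)`. -/
lemma exists_ML_eq {v : Ω → ℝ} {D : Set Ω} (hO : IsOpen D) (hD : Dense D)
    (hv : ContinuousOn v D) : ∃ u : ML Ω 0, ∀ x ∈ D, u.1 x = v x := by
  obtain ⟨hΓ, hΓ'⟩ := isClosed_isNowhereDense_iff_compl (s := Dᶜ).2 (by simpa using ⟨hO, hD⟩)
  exact ⟨⟨_, isML_baireIS v hΓ hΓ' (by rwa [compl_compl])⟩, fun x hx =>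
    baireIS_eq_of_continuousOn hO (continuous_coe_real_ereal.comp_continuousOn hv) hx⟩

lemma exists_continuousOn_comp {ι : Type} [Finite ι] {g : Ω × (ι → ℝ) → ℝ} (hg : Continuous g)
    (u : ι → ML Ω 0) : ∃ D : Set Ω, IsOpen D ∧ Dense D ∧
      ContinuousOn (fun x => g (x, fun i => ((u i).1 x).toReal)) D := by
  choose D h1 h2 _ h4 using fun i => (u i).exists_continuousOn
  refine ⟨⋂ i, D i, isOpen_iInter_of_finite h1, dense_iInter_of_isOpen h1 h2, ?_⟩
  exact hg.comp_continuousOn (continuousOn_id.prodMk (continuousOn_pi.2 fun i =>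
    (h4 i).mono (Set.iInter_subset D i)))

/-- `I ∘ S` does not change a continuous function of finitely many elements of `ML^0(Ω)` on a
residual set. -/
lemma eventually_baireIS_comp {ι : Type} [Finite ι] {g : Ω × (ι → ℝ) → ℝ} (hg : Continuous g)
    (u : ι → ML Ω 0) : ∀ᶠ x in residual Ω,
      baireIS (fun x => (g (x, fun i => ((u i).1 x).toReal) : EReal)) x =
        g (x, fun i => ((u i).1 x).toReal) := by
  obtain ⟨D, h1, h2, h3⟩ := exists_continuousOn_comp hg u
  exact mem_of_superset (residual_of_dense_open h1 h2) fun x hx =>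
    baireIS_eq_of_continuousOn h1 (continuous_coe_real_ereal.comp_continuousOn h3) hx

/-- A continuous function of finitely many elements of `ML^0(Ω)` is represented, on a residual set,
by an element of `ML^0(Ω)`. -/
lemma exists_ML_comp {ι : Type} [Finite ι] {g : Ω × (ι → ℝ) → ℝ} (hg : Continuous g)
    (u : ι → ML Ω 0) :
    ∃ w : ML Ω 0, ∀ᶠ x in residual Ω, w.1 x = g (x, fun i => ((u i).1 x).toReal) := by
  obtain ⟨D, h1, h2, h3⟩ := exists_continuousOn_comp hg u
  obtain ⟨w, hw⟩ := exists_ML_eq h1 h2 h3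
  exact ⟨w, mem_of_superset (residual_of_dense_open h1 h2) hw⟩

/-- Restriction to an open set commutes with `I ∘ S`, so it maps `ML^0(Ω)` into `ML^0(V)`. -/
lemma isML_restrictTo {V : Opens (E n)} (hV : V ≤ Ω) (u : ML Ω 0) :
    IsML 0 (restrictTo hV u.1) := by
  have he : IsOpenEmbedding (Set.inclusion (SetLike.coe_subset_coe.2 hV)) :=
    Opens.isOpenEmbedding_of_le hV
  obtain ⟨h, D, h1, h2, h3, h4⟩ := isML_zero_iff.1 u.2
  refine isML_zero_iff.2 ⟨?_, Set.inclusion (SetLike.coe_subset_coe.2 hV) ⁻¹' D,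
    h1.preimage he.continuous, h2.preimage he.isOpenMap, fun x hx => h3 _ hx,
    h4.comp he.continuous.continuousOn fun x hx => hx⟩
  have := baireIS_comp he u.1
  rw [h] at this
  exact this

end ML

/-! ### Admissible sequences of order intervals -/

section Squeeze

variable {n : ℕ} {Ω : Opens (E n)}

/-- The sequences `a` and `b` in `ML^0(Ω)` squeeze a real function: outside a meagre set, `a r`
increases and `b r` decreases to the same finite limit. -/
def IsSqueeze (a b : ℕ → ML Ω 0) : Prop :=
  ∀ᶠ x in residual Ω, ∃ (α β : ℕ → ℝ) (y : ℝ), (∀ r, (a r).1 x = α r) ∧ (∀ r, (b r).1 x = β r) ∧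
    Monotone α ∧ Antitone β ∧ Tendsto α atTop (𝓝 y) ∧ Tendsto β atTop (𝓝 y)

variable {a b : ℕ → ML Ω 0}

lemma IsSqueeze.monotone (h : IsSqueeze a b) : Monotone a := fun r s hrs =>
  ML.le_iff_residual.2 <| h.mono fun x ⟨α, _, _, h1, _, h2, _⟩ => by
    rw [h1, h1]
    exact_mod_cast h2 hrs

lemma IsSqueeze.antitone (h : IsSqueeze a b) : Antitone b := fun r s hrs =>
  ML.le_iff_residual.2 <| h.mono fun x ⟨_, β, _, _, h1, _, h2, _⟩ => by
    rw [h1, h1]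
    exact_mod_cast h2 hrs

lemma IsSqueeze.le (h : IsSqueeze a b) (r : ℕ) : a r ≤ b r :=
  ML.le_iff_residual.2 <| h.mono fun x ⟨α, β, y, h1, h2, h3, h4, h5, h6⟩ => by
    rw [h1, h2]
    exact_mod_cast (h3.ge_of_tendsto h5 r).trans (h4.le_of_tendsto h6 r)

lemma eq_of_tendsto_squeeze {α β : ℕ → ℝ} {y : ℝ} (hα : Tendsto α atTop (𝓝 y))
    (hβ : Tendsto β atTop (𝓝 y)) {t : EReal} (ht : ∀ r, (α r : EReal) ≤ t ∧ t ≤ β r) : t = y :=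
  le_antisymm (ge_of_tendsto' (EReal.tendsto_coe.2 hβ) fun r => (ht r).2)
    (le_of_tendsto' (EReal.tendsto_coe.2 hα) fun r => (ht r).1)

/-- Two families of functions between `a` and `b`, each of which restricts to a single function on
`V`, have the same restriction. -/
lemma IsSqueeze.eqOn (h : IsSqueeze a b) {V : Set Ω} (hV : IsOpen V) {u v : ℕ → ML Ω 0}
    (hu : ∀ r, u r ∈ Set.Icc (a r) (b r)) (hv : ∀ r, v r ∈ Set.Icc (a r) (b r))
    (hu' : ∀ r, ∀ x ∈ V, (u r).1 x = (u 0).1 x) (hv' : ∀ r, ∀ x ∈ V, (v r).1 x = (v 0).1 x)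
    {x : Ω} (hx : x ∈ V) : (u 0).1 x = (v 0).1 x := by
  have key : ∀ᶠ x in residual Ω, x ∈ V → (u 0).1 x = (v 0).1 x := h.mono fun x hx hxV => by
    obtain ⟨α, β, y, h1, h2, -, -, h5, h6⟩ := hx
    rw [eq_of_tendsto_squeeze h5 h6 (t := (u 0).1 x), eq_of_tendsto_squeeze h5 h6 (t := (v 0).1 x)]
    · intro r
      rw [← hv' r x hxV, ← h1, ← h2]
      exact ⟨(hv r).1 x, (hv r).2 x⟩
    · intro r
      rw [← hu' r x hxV, ← h1, ← h2]
      exact ⟨(hu r).1 x, (hu r).2 x⟩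
  exact le_antisymm (ML.le_of_residual hV (key.mono fun _ h hx => (h hx).le) hx)
    (ML.le_of_residual hV (key.mono fun _ h hx => (h hx).ge) hx)

lemma IsSqueeze.isAdmissible (h : IsSqueeze a b) :
    IsAdmissible fun r => Set.Icc (a r) (b r) where
  interval r := ⟨a r, b r, rfl⟩
  nonempty r := ⟨a r, le_rfl, h.le r⟩
  decreasing r := Set.Icc_subset_Icc (h.monotone r.le_succ) (h.antitone r.le_succ)
  inter V hV := by
    refine (interRestrict (fun r => Set.Icc (a r) (b r)) hV).eq_empty_or_nonempty.imp id ?_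
    rintro ⟨f, hf⟩
    have hrep : ∀ {f}, f ∈ interRestrict (fun r => Set.Icc (a r) (b r)) hV →
        ∃ u : ℕ → ML Ω 0, (∀ r, u r ∈ Set.Icc (a r) (b r)) ∧ ∀ r, restrictTo hV (u r).1 = f :=
      fun {f} hf => by
        choose u hu using Set.mem_iInter.1 hf
        exact ⟨u, fun r => (hu r).1, fun r => (hu r).2⟩
    obtain ⟨u, hu, huf⟩ := hrep hf
    refine ⟨⟨f, huf 0 ▸ isML_restrictTo hV (u 0)⟩, Set.eq_singleton_iff_unique_mem.2 ⟨hf, ?_⟩⟩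
    intro g hg
    obtain ⟨v, hv, hvg⟩ := hrep hg
    funext x
    change g x = f x
    rw [← huf 0, ← hvg 0]
    have hloc : ∀ {w : ℕ → ML Ω 0} {f : V → EReal}, (∀ r, restrictTo hV (w r).1 = f) → ∀ r,
        ∀ x ∈ (Subtype.val ⁻¹' (V : Set (E n)) : Set Ω), (w r).1 x = (w 0).1 x :=
      fun {w f} hw r x hx => congrFun ((hw r).trans (hw 0).symm) ⟨x, hx⟩
    exact h.eqOn (V.isOpen.preimage continuous_subtype_val) hv hu (hloc hvg) (hloc huf)
      (x := ⟨x, hV x.2⟩) x.2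

/-- A constant between `u` and `v` on the open set `V` is extended to an element of `ML^0(Ω)`
between `u` and `v`. -/
lemma exists_ML_extend_const {u v : ML Ω 0} (huv : u ≤ v) {V : Set Ω} (hV : IsOpen V) {c : ℝ}
    (hu : ∀ᶠ x in residual Ω, x ∈ V → u.1 x ≤ c) (hv : ∀ᶠ x in residual Ω, x ∈ V → c ≤ v.1 x) :
    ∃ w ∈ Set.Icc u v, ∀ x ∈ V, w.1 x = c := by
  classical
  obtain ⟨D, hDo, hD, hDu, hDc⟩ := u.exists_continuousOn
  have hO : IsOpen (V ∪ D ∩ (closure V)ᶜ) := hV.union (hDo.inter isClosed_closure.isOpen_compl)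
  have hdense : Dense (V ∪ D ∩ (closure V)ᶜ) := by
    refine dense_iff_inter_open.2 fun W hW hWne => ?_
    by_cases hWV : (W ∩ V).Nonempty
    · exact hWV.mono (Set.inter_subset_inter_right _ Set.subset_union_left)
    · obtain ⟨x, hxW, hxD⟩ := dense_iff_inter_open.1 hD W hW hWne
      exact ⟨x, hxW, .inr ⟨hxD, fun hx => hWV (mem_closure_iff.1 hx W hW hxW)⟩⟩
  obtain ⟨w, hw⟩ := exists_ML_eq (v := fun x => if x ∈ V then c else (u.1 x).toReal) hO hdense <| by
    rintro x (hx | ⟨hxD, hx⟩)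
    · refine ContinuousAt.continuousWithinAt ((continuousAt_const (y := c)).congr ?_)
      filter_upwards [hV.mem_nhds hx] with z hz
      rw [if_pos hz]
    · refine ContinuousAt.continuousWithinAt ((hDc.continuousAt (hDo.mem_nhds hxD)).congr ?_)
      filter_upwards [isClosed_closure.isOpen_compl.mem_nhds hx] with z hz
      rw [if_neg fun h => hz (subset_closure h)]
  have hres : ∀ᶠ x in residual Ω, x ∈ V ∪ D ∩ (closure V)ᶜ := residual_of_dense_open hO hdense
  refine ⟨w, ⟨ML.le_iff_residual.2 ?_, ML.le_iff_residual.2 ?_⟩, fun x hx => ?_⟩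
  · filter_upwards [hres, hu, u.eventually_coe_toReal] with x hx hxu hxr
    rw [hw x hx]
    split_ifs with h
    exacts [hxu h, hxr.ge]
  · filter_upwards [hres, hv, u.eventually_coe_toReal] with x hx hxv hxr
    rw [hw x hx]
    split_ifs with h
    exacts [hxv h, hxr.le.trans (huv x)]
  · rw [hw x (.inl hx), if_pos hx]

/-- The order intervals of an admissible sequence leave no gap: outside a meagre set, no interval
`[p, q]` with `p < q` lies between all the lower and all the upper end points. Otherwise, on some
open set, both constants `p` and `q` would belong to the intersection of the restrictions. -/
lemma IsAdmissible.eventually_exists_lt (h : IsAdmissible fun r => Set.Icc (a r) (b r))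
    {p q : ℝ} (hpq : p < q) :
    ∀ᶠ x in residual Ω, ∃ r, p < ((a r).1 x).toReal ∨ ((b r).1 x).toReal < q := by
  have hle : ∀ r, a r ≤ b r := fun r => Set.nonempty_Icc.1 (h.nonempty r)
  choose A hA1 hA2 hA3 hA4 using fun r => (a r).exists_continuousOn
  choose B hB1 hB2 hB3 hB4 using fun r => (b r).exists_continuousOn
  have hO : IsOpen (⋃ r, A r ∩ (fun x => ((a r).1 x).toReal) ⁻¹' Set.Ioi p ∪
      B r ∩ (fun x => ((b r).1 x).toReal) ⁻¹' Set.Iio q) :=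
    isOpen_iUnion fun r => ((hA4 r).isOpen_inter_preimage (hA1 r) isOpen_Ioi).union
      ((hB4 r).isOpen_inter_preimage (hB1 r) isOpen_Iio)
  by_cases hd : Dense (⋃ r, A r ∩ (fun x => ((a r).1 x).toReal) ⁻¹' Set.Ioi p ∪
      B r ∩ (fun x => ((b r).1 x).toReal) ⁻¹' Set.Iio q)
  · refine mem_of_superset (residual_of_dense_open hO hd) fun x hx => ?_
    obtain ⟨r, hr⟩ := Set.mem_iUnion.1 hx
    exact ⟨r, hr.imp (fun h => h.2) fun h => h.2⟩
  · rw [dense_iff_inter_open] at hd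
    push Not at hd
    obtain ⟨V, hV, ⟨x₀, hx₀⟩, hVO⟩ := hd
    have hVO' : ∀ x ∈ V, ∀ r, ¬(x ∈ A r ∧ p < ((a r).1 x).toReal) ∧
        ¬(x ∈ B r ∧ ((b r).1 x).toReal < q) := fun x hx r => by
      have h1 := fun h => Set.eq_empty_iff_forall_notMem.1 hVO x ⟨hx, Set.mem_iUnion.2 ⟨r, h⟩⟩
      exact ⟨fun h => h1 (.inl h), fun h => h1 (.inr h)⟩
    have hW : (⟨Subtype.val '' V, isOpen_image_val hV⟩ : Opens (E n)) ≤ Ω := by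
      rintro _ ⟨x, -, rfl⟩
      exact x.2
    have hmem : ∀ c ∈ Set.Icc p q, (fun _ => (c : EReal)) ∈
        interRestrict (fun r => Set.Icc (a r) (b r)) hW := fun c hc => by
      refine Set.mem_iInter.2 fun r => ?_
      obtain ⟨w, hw, hwV⟩ := exists_ML_extend_const (hle r) hV (c := c)
        (mem_of_superset (residual_of_dense_open (hA1 r) (hA2 r)) fun x hx hxV => by
          rw [← hA3 r x hx, EReal.coe_le_coe_iff]
          exact (not_lt.1 fun h => (hVO' x hxV r).1 ⟨hx, h⟩).trans hc.1)
        (mem_of_superset (residual_of_dense_open (hB1 r) (hB2 r)) fun x hx hxV => by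
          rw [← hB3 r x hx, EReal.coe_le_coe_iff]
          exact hc.2.trans (not_lt.1 fun h => (hVO' x hxV r).2 ⟨hx, h⟩))
      refine ⟨w, hw, funext ?_⟩
      rintro ⟨_, x, hx, rfl⟩
      exact hwV x hx
    have hp := hmem p ⟨le_rfl, hpq.le⟩
    have hq := hmem q ⟨hpq.le, le_rfl⟩
    rcases h.inter _ hW with h0 | ⟨w, h0⟩
    · rw [h0] at hp
      exact hp.elim
    · rw [h0] at hp hq
      have := congrFun (hp.trans hq.symm) ⟨x₀, x₀, hx₀, rfl⟩
      exact (hpq.ne (by exact_mod_cast this)).elim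

lemma IsAdmissible.exists_isSqueeze {I : ℕ → Set (ML Ω 0)} (h : IsAdmissible I) :
    ∃ a b : ℕ → ML Ω 0, IsSqueeze a b ∧ I = fun r => Set.Icc (a r) (b r) := by
  choose a b hab using h.interval
  obtain rfl : I = fun r => Set.Icc (a r) (b r) := funext hab
  have hle : ∀ r, a r ≤ b r := fun r => Set.nonempty_Icc.1 (h.nonempty r)
  have hstep := fun r => (Set.Icc_subset_Icc_iff (hle (r + 1))).1 (h.decreasing r)
  have ha : Monotone a := monotone_nat_of_le_succ fun r => (hstep r).1
  have hb : Antitone b := antitone_nat_of_succ_le fun r => (hstep r).2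
  refine ⟨a, b, ?_, rfl⟩
  have hgap : ∀ᶠ x in residual Ω, ∀ p q : ℚ, p < q →
      ∃ r, (p : ℝ) < ((a r).1 x).toReal ∨ ((b r).1 x).toReal < q := by
    refine eventually_countable_forall.2 fun p => eventually_countable_forall.2 fun q => ?_
    by_cases hpq : p < q
    · exact (h.eventually_exists_lt (p := p) (q := q) (by exact_mod_cast hpq)).mono fun _ hx _ => hx
    · exact .of_forall fun _ h => (hpq h).elim
  filter_upwards [hgap, eventually_countable_forall.2 fun r => (a r).eventually_coe_toReal,
    eventually_countable_forall.2 fun r => (b r).eventually_coe_toReal] with x hx hxa hxb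
  have hα : Monotone fun r => ((a r).1 x).toReal := fun r s hrs => by
    rw [← EReal.coe_le_coe_iff, hxa, hxa]
    exact ha hrs x
  have hβ : Antitone fun r => ((b r).1 x).toReal := fun r s hrs => by
    rw [← EReal.coe_le_coe_iff, hxb, hxb]
    exact hb hrs x
  have hαβ : ∀ r s, ((a r).1 x).toReal ≤ ((b s).1 x).toReal := fun r s => by
    rw [← EReal.coe_le_coe_iff, hxa, hxb]
    exact (ha (le_max_left r s)).trans ((hle _).trans (hb (le_max_right r s))) x
  have hα' := tendsto_atTop_ciSup hα ⟨_, Set.forall_mem_range.2 fun r => hαβ r 0⟩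
  have hβ' := tendsto_atTop_ciInf hβ ⟨_, Set.forall_mem_range.2 fun s => hαβ 0 s⟩
  refine ⟨_, _, _, fun r => (hxa r).symm, fun r => (hxb r).symm, hα, hβ, hα', ?_⟩
  have heq : (⨆ r, ((a r).1 x).toReal) = ⨅ r, ((b r).1 x).toReal := by
    refine le_antisymm (ciSup_le fun r => le_ciInf fun s => hαβ r s) (not_lt.1 fun hlt => ?_)
    obtain ⟨q, hq1, hq2⟩ := exists_rat_btwn hlt
    obtain ⟨p, hp1, hp2⟩ := exists_rat_btwn hq1
    obtain ⟨r, hr | hr⟩ := hx p q (by exact_mod_cast hp2)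
    · exact (hr.trans_le (hα.ge_of_tendsto hα' r)).not_gt hp1
    · exact ((hβ.le_of_tendsto hβ' r).trans_lt hr).not_gt hq2
  rwa [heq]

end Squeeze

/-! ### The uniform order convergence structure -/

section OrderStructure

variable {n : ℕ} {Ω : Opens (E n)} {a b c d : ℕ → ML Ω 0}

/-- The filter generated by the order intervals `[a r, b r]`. -/
def intervalFilter (a b : ℕ → ML Ω 0) : Filter (ML Ω 0) := ⨅ r, 𝓟 (Set.Icc (a r) (b r))

lemma Icc_mem_intervalFilter (a b : ℕ → ML Ω 0) (r : ℕ) :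
    Set.Icc (a r) (b r) ∈ intervalFilter a b :=
  mem_iInf_of_mem r (mem_principal_self _)

lemma prod_intervalFilter_mem (h : IsSqueeze a b) :
    intervalFilter a b ×ˢ intervalFilter a b ∈ orderStructure Ω :=
  ⟨1, fun _ r => Set.Icc (a r) (b r), fun _ => h.isAdmissible, le_iSup_of_le 0 le_rfl⟩

lemma orderStructure_mono {U V : Filter (ML Ω 0 × ML Ω 0)} (hU : U ∈ orderStructure Ω)
    (hV : V ≤ U) : V ∈ orderStructure Ω := by
  obtain ⟨k, I, hI, h⟩ := hU
  exact ⟨k, I, hI, hV.trans h⟩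

lemma bot_mem_orderStructure : ⊥ ∈ orderStructure Ω :=
  ⟨0, fun i => i.elim0, fun i => i.elim0, bot_le⟩

lemma orderStructure_sup {U V : Filter (ML Ω 0 × ML Ω 0)} (hU : U ∈ orderStructure Ω)
    (hV : V ∈ orderStructure Ω) : U ⊔ V ∈ orderStructure Ω := by
  obtain ⟨k, I, hI, h⟩ := hU
  obtain ⟨l, I', hI', h'⟩ := hV
  refine ⟨k + l, Fin.append I I', fun i => ?_, sup_le (h.trans ?_) (h'.trans ?_)⟩
  · induction i using Fin.addCases with
    | left i => rw [Fin.append_left]; exact hI i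
    | right i => rw [Fin.append_right]; exact hI' i
  · exact iSup_le fun i => le_iSup_of_le (Fin.castAdd l i) (by rw [Fin.append_left])
  · exact iSup_le fun i => le_iSup_of_le (Fin.natAdd k i) (by rw [Fin.append_right])

/-- The filters `𝓘 × 𝓘`, for the filters `𝓘` generated by squeezing intervals, generate the
order structure under finite intersections and refinement. -/
lemma orderStructure_induction {P : Filter (ML Ω 0 × ML Ω 0) → Prop}
    (hmono : ∀ U V, P U → V ≤ U → P V) (hbot : P ⊥) (hsup : ∀ U V, P U → P V → P (U ⊔ V))
    (hsq : ∀ a b, IsSqueeze a b → P (intervalFilter a b ×ˢ intervalFilter a b))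
    {U : Filter (ML Ω 0 × ML Ω 0)} (hU : U ∈ orderStructure Ω) : P U := by
  obtain ⟨k, I, hI, h⟩ := hU
  refine hmono _ _ ?_ h
  rw [← Finset.sup_univ_eq_iSup]
  refine Finset.sup_induction hbot (fun U hU V hV => hsup U V hU hV) fun i _ => ?_
  obtain ⟨a, b, hab, hi⟩ := (hI i).exists_isSqueeze
  rw [hi]
  exact hsq a b hab

/-- Two squeezing sequences of intervals that keep meeting each other squeeze the same function,
and so do the intervals that span them. -/
lemma IsSqueeze.exists_hull (hab : IsSqueeze a b) (hcd : IsSqueeze c d)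
    (hmeet : ∀ r, (Set.Icc (a r) (b r) ∩ Set.Icc (c r) (d r)).Nonempty) :
    ∃ u v : ℕ → ML Ω 0, IsSqueeze u v ∧
      intervalFilter a b ≤ intervalFilter u v ∧ intervalFilter c d ≤ intervalFilter u v := by
  have hmin : Continuous fun p : Ω × (Bool → ℝ) => min (p.2 true) (p.2 false) := by fun_prop
  have hmax : Continuous fun p : Ω × (Bool → ℝ) => max (p.2 true) (p.2 false) := by fun_prop
  choose u hu using fun r => exists_ML_comp hmin fun i => bif i then a r else c r
  choose v hv using fun r => exists_ML_comp hmax fun i => bif i then b r else d r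
  choose w hw hw' using hmeet
  simp only [cond_true, cond_false] at hu hv
  have hu' := eventually_countable_forall.2 hu
  have hv' := eventually_countable_forall.2 hv
  have hle : (∀ r, u r ≤ a r) ∧ (∀ r, b r ≤ v r) ∧ (∀ r, u r ≤ c r) ∧ ∀ r, d r ≤ v r := by
    refine ⟨fun r => ?_, fun r => ?_, fun r => ?_, fun r => ?_⟩ <;> rw [ML.le_iff_residual]
    · filter_upwards [hu r, (a r).eventually_coe_toReal] with x h1 h2
      rw [h1, ← h2, EReal.toReal_coe]
      exact_mod_cast min_le_left _ _
    · filter_upwards [hv r, (b r).eventually_coe_toReal] with x h1 h2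
      rw [h1, ← h2, EReal.toReal_coe]
      exact_mod_cast le_max_left _ _
    · filter_upwards [hu r, (c r).eventually_coe_toReal] with x h1 h2
      rw [h1, ← h2, EReal.toReal_coe]
      exact_mod_cast min_le_right _ _
    · filter_upwards [hv r, (d r).eventually_coe_toReal] with x h1 h2
      rw [h1, ← h2, EReal.toReal_coe]
      exact_mod_cast le_max_right _ _
  refine ⟨u, v, ?_, le_iInf fun r => ?_, le_iInf fun r => ?_⟩
  · filter_upwards [hab, hcd, hu', hv',
      eventually_countable_forall.2 fun r => (w r).eventually_coe_toReal] with x hx hx' hux hvx hwx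
    obtain ⟨α, β, y, h1, h2, h3, h4, h5, h6⟩ := hx
    obtain ⟨γ, δ, z, k1, k2, k3, k4, k5, k6⟩ := hx'
    simp only [h1, h2, k1, k2, EReal.toReal_coe] at hux hvx
    -- Elements `w r` of the common part of the intervals converge to both limits.
    have hwy : Tendsto (fun r => ((w r).1 x).toReal) atTop (𝓝 y) := by
      refine tendsto_of_tendsto_of_tendsto_of_le_of_le h5 h6 (fun r => ?_) fun r => ?_
      · have := (hw r).1 x
        rwa [h1, ← hwx, EReal.coe_le_coe_iff] at this
      · have := (hw r).2 x
        rwa [h2, ← hwx, EReal.coe_le_coe_iff] at this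
    have hwz : Tendsto (fun r => ((w r).1 x).toReal) atTop (𝓝 z) := by
      refine tendsto_of_tendsto_of_tendsto_of_le_of_le k5 k6 (fun r => ?_) fun r => ?_
      · have := (hw' r).1 x
        rwa [k1, ← hwx, EReal.coe_le_coe_iff] at this
      · have := (hw' r).2 x
        rwa [k2, ← hwx, EReal.coe_le_coe_iff] at this
    obtain rfl := tendsto_nhds_unique hwy hwz
    refine ⟨fun r => min (α r) (γ r), fun r => max (β r) (δ r), y, hux, hvx, h3.min k3, h4.max k4,
      ?_, ?_⟩
    · simpa only [min_self] using h5.min k5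
    · simpa only [max_self] using h6.max k6
  · exact le_principal_iff.2 (mem_of_superset (Icc_mem_intervalFilter a b r)
      (Set.Icc_subset_Icc (hle.1 r) (hle.2.1 r)))
  · exact le_principal_iff.2 (mem_of_superset (Icc_mem_intervalFilter c d r)
      (Set.Icc_subset_Icc (hle.2.2.1 r) (hle.2.2.2 r)))

lemma compFilter_intervalFilter_mem (hab : IsSqueeze a b) (hcd : IsSqueeze c d) :
    compFilter (intervalFilter a b ×ˢ intervalFilter a b)
      (intervalFilter c d ×ˢ intervalFilter c d) ∈ orderStructure Ω := by
  by_cases hmeet : ∀ r, (Set.Icc (a r) (b r) ∩ Set.Icc (c r) (d r)).Nonempty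
  · obtain ⟨u, v, huv, h1, h2⟩ := hab.exists_hull hcd hmeet
    exact orderStructure_mono (prod_intervalFilter_mem huv)
      ((compFilter_prod_le _ _ _ _).trans (prod_mono h2 h1))
  · push Not at hmeet
    obtain ⟨r, hr⟩ := hmeet
    rw [compFilter_prod_eq_bot (Filter.disjoint_iff.2 ⟨_, Icc_mem_intervalFilter c d r, _,
      Icc_mem_intervalFilter a b r, (Set.disjoint_iff_inter_eq_empty.2 hr).symm⟩)]
    exact bot_mem_orderStructure

lemma isSqueeze_const (u : ML Ω 0) : IsSqueeze (fun _ => u) fun _ => u :=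
  u.eventually_coe_toReal.mono fun _ hx => ⟨_, _, _, fun _ => hx.symm, fun _ => hx.symm,
    monotone_const, antitone_const, tendsto_const_nhds, tendsto_const_nhds⟩

lemma isUniformConvergenceStructure_orderStructure (Ω : Opens (E n)) :
    IsUniformConvergenceStructure (orderStructure Ω) where
  pure_mem u := by
    have hu : pure u ≤ intervalFilter (fun _ => u) fun _ => u :=
      le_iInf fun _ => le_principal_iff.2 (mem_pure.2 ⟨le_rfl, le_rfl⟩)
    exact orderStructure_mono (prod_intervalFilter_mem (isSqueeze_const u)) (prod_mono hu hu)
  sup_mem _ hU _ hV := orderStructure_sup hU hV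
  mono _ hU _ hV := orderStructure_mono hU hV
  swap_mem U hU := by
    refine orderStructure_induction (P := fun U => map Prod.swap U ∈ orderStructure Ω)
      (fun U V hU hV => orderStructure_mono hU (map_mono hV)) ?_ (fun U V hU hV => ?_)
      (fun a b hab => ?_) hU
    · rw [Filter.map_bot]
      exact bot_mem_orderStructure
    · rw [map_sup]
      exact orderStructure_sup hU hV
    · rw [map_swap_prod]
      exact prod_intervalFilter_mem hab
  comp_mem U hU V hV := by
    have hbot : ∀ W : Filter (ML Ω 0 × ML Ω 0), compFilter ⊥ W = ⊥ ∧ compFilter W ⊥ = ⊥ :=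
      fun W => ⟨empty_mem_iff_bot.1 (mem_compFilter.2
          ⟨∅, mem_bot, Set.univ, univ_mem, fun p ⟨_, _, h⟩ => h⟩),
        empty_mem_iff_bot.1 (mem_compFilter.2
          ⟨Set.univ, univ_mem, ∅, mem_bot, fun p ⟨_, h, _⟩ => h⟩)⟩
    refine orderStructure_induction (P := fun U => compFilter U V ∈ orderStructure Ω)
      (fun U U' hU hU' => orderStructure_mono hU (compFilter_mono hU' le_rfl)) ?_
      (fun U U' hU hU' => orderStructure_mono (orderStructure_sup hU hU')
        (compFilter_sup_left _ _ _)) (fun a b hab => ?_) hU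
    · rw [(hbot V).1]
      exact bot_mem_orderStructure
    refine orderStructure_induction (P := fun V => compFilter _ V ∈ orderStructure Ω)
      (fun V V' hV hV' => orderStructure_mono hV (compFilter_mono le_rfl hV')) ?_
      (fun V V' hV hV' => orderStructure_mono (orderStructure_sup hV hV')
        (compFilter_sup_right _ _ _)) (fun c d hcd => compFilter_intervalFilter_mem hab hcd) hV
    rw [(hbot _).2]
    exact bot_mem_orderStructure

/-- Two elements of `ML^0(Ω)` that lie in the same squeezing intervals agree. -/
lemma eq_of_pure_mem_orderStructure {u v : ML Ω 0}
    (h : (pure u ×ˢ pure v : Filter (ML Ω 0 × ML Ω 0)) ∈ orderStructure Ω) : u = v := by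
  obtain ⟨k, I, hI, h⟩ := h
  rw [prod_pure_pure] at h
  have hex : ∃ i, ∀ r, u ∈ I i r ∧ v ∈ I i r := by
    by_contra! hne
    choose r hr using hne
    have : {(u, v)}ᶜ ∈ ⨆ i, (⨅ r, 𝓟 (I i r)) ×ˢ (⨅ r, 𝓟 (I i r)) := by
      refine mem_iSup.2 fun i => ?_
      have hi : I i (r i) ∈ ⨅ r, 𝓟 (I i r) := mem_iInf_of_mem (r i) (mem_principal_self _)
      refine mem_of_superset (prod_mem_prod hi hi) ?_
      rintro p ⟨h1, h2⟩ rfl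
      exact hr i h1 h2
    exact mem_pure.1 (h this) rfl
  obtain ⟨i, hi⟩ := hex
  obtain ⟨a, b, hab, hIi⟩ := (hI i).exists_isSqueeze
  rw [hIi] at hi
  exact Subtype.ext (funext fun x => hab.eqOn isOpen_univ (u := fun _ => u) (v := fun _ => v)
    (fun r => (hi r).1) (fun r => (hi r).2) (fun _ _ _ => rfl) (fun _ _ _ => rfl) (Set.mem_univ x))

lemma isHausdorff_orderStructure (Ω : Opens (E n)) : IsHausdorff (orderStructure Ω) :=
  fun _ _ _ _ hu hv =>
    have hU := isUniformConvergenceStructure_orderStructure Ω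
    eq_of_pure_mem_orderStructure (hU.prod_trans (hU.prod_swap hu) hv)

/-- The operator `𝒟^α` with `α = 0` is the inclusion, so the operators `𝒟^α` separate points. -/
lemma extD_zero {l : ℕ} (u : ML Ω l) : (extD ⟨0, by simp⟩ u : ML Ω 0).1 = u.1 := by
  obtain ⟨⟨h, -⟩, Γ, hΓ, hΓ', hfin, -⟩ := u.2
  obtain ⟨hO, hD⟩ := isClosed_isNowhereDense_iff_compl.1 ⟨hΓ, hΓ'⟩
  have h0 : ∀ f : E n → ℝ, multiD 0 f = f := fun f => by
    unfold multiD
    induction List.finRange n with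
    | nil => rfl
    | cons i L ih => exact ih
  have heq : ∀ x ∈ Γᶜ, (realPart u.1 (x : E n) : EReal) = u.1 x := fun x hx => by
    rw [realPart_val, EReal.coe_toReal (hfin x hx).1 (hfin x hx).2]
  conv_rhs => rw [← h]
  change (baireIS fun x : Ω => (multiD 0 (realPart u.1) (x : E n) : EReal)) = _
  rw [h0]
  funext x
  exact le_antisymm
    (baireIS_le_baireIS isOpen_univ hO hD (fun y _ hy => (heq y hy).le) (Set.mem_univ x))
    (baireIS_le_baireIS isOpen_univ hO hD (fun y _ hy => (heq y hy).ge) (Set.mem_univ x))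

lemma isUniformConvergenceStructure_initialStructure (Ω : Opens (E n)) (l : ℕ) :
    IsUniformConvergenceStructure (initialStructure Ω l) :=
  isUniformConvergenceStructure_initial fun _ => isUniformConvergenceStructure_orderStructure Ω

lemma isHausdorff_initialStructure (Ω : Opens (E n)) (l : ℕ) :
    IsHausdorff (initialStructure Ω l) := by
  refine isHausdorff_initial (fun _ => isHausdorff_orderStructure Ω) fun u v huv => Subtype.ext ?_
  rw [← extD_zero u, ← extD_zero v, huv]

lemma exists_isCompletion_productStructure {X : Type} {J : Set (Filter (X × X))} (ι : Type)
    (h : IsUniformConvergenceStructure J) (hH : IsHausdorff J) :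
    ∃ (X' : Type) (J' : Set (Filter (X' × X'))) (e : (ι → X) → X'),
      IsCompletion (productStructure ι J) J' e :=
  ⟨_, _, _, isCompletion_toCompletion (isUniformConvergenceStructure_initial fun _ => h)
    (isHausdorff_initial (fun _ => hH) fun _ _ => funext)⟩

end OrderStructure

/-! ### Uniform continuity of the nonlinear operator -/

section Operator

/-- The point of the box `∏ [s p, t p]` with relative coordinates `θ`. -/
def boxPoint {ι : Type} (s t θ : ι → ℝ) : ι → ℝ := fun p => (1 - θ p) * s p + θ p * t p

/-- The unit cube of relative coordinates. -/
def unitBox (ι : Type) : Set (ι → ℝ) := Set.univ.pi fun _ => Set.Icc 0 1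

variable {ι : Type}

lemma isCompact_unitBox : IsCompact (unitBox ι) := isCompact_univ_pi fun _ => isCompact_Icc

lemma image_boxPoint {s t : ι → ℝ} (hst : s ≤ t) : boxPoint s t '' unitBox ι = Set.Icc s t := by
  ext ξ
  constructor
  · rintro ⟨θ, hθ, rfl⟩
    refine ⟨fun p => ?_, fun p => ?_⟩ <;> have h1 := hθ p trivial <;> have h2 := hst p <;>
      simp only [boxPoint]
    · nlinarith [mul_nonneg h1.1 (sub_nonneg.2 h2)]
    · nlinarith [mul_nonneg (sub_nonneg.2 h1.2) (sub_nonneg.2 h2)]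
  · rintro ⟨h1, h2⟩
    have hp : ∀ p, ∃ θ ∈ Set.Icc (0 : ℝ) 1, (1 - θ) * s p + θ * t p = ξ p := fun p => by
      have h3 : ξ p ∈ segment ℝ (s p) (t p) := by
        rw [segment_eq_Icc (hst p)]
        exact ⟨h1 p, h2 p⟩
      rw [segment_eq_image] at h3
      exact h3
    choose θ hθ hξ using hp
    exact ⟨θ, fun p _ => hθ p, funext hξ⟩

/-- The minimum of `F(x, ·)` over the box `∏ [s p, t p]`. The box is parametrized by the unit cube,
so that the minimum is taken over a fixed compact set and depends continuously on `(x, s, t)`. -/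
noncomputable def boxInf {X : Type} (F : X × (ι → ℝ) → ℝ) (x : X) (s t : ι → ℝ) : ℝ :=
  sInf ((fun θ => F (x, boxPoint s t θ)) '' unitBox ι)

lemma image_comp_boxPoint {X : Type} (F : X × (ι → ℝ) → ℝ) (x : X) {s t : ι → ℝ} (hst : s ≤ t) :
    (fun θ => F (x, boxPoint s t θ)) '' unitBox ι = (fun ξ => F (x, ξ)) '' Set.Icc s t := by
  rw [← image_boxPoint hst, Set.image_image]

lemma boxInf_self {X : Type} (F : X × (ι → ℝ) → ℝ) (x : X) (s : ι → ℝ) :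
    boxInf F x s s = F (x, s) := by
  rw [boxInf, image_comp_boxPoint F x le_rfl, Set.Icc_self, Set.image_singleton, csInf_singleton]

variable {X : Type} [TopologicalSpace X] {F : X × (ι → ℝ) → ℝ}

lemma continuous_boxInf (hF : Continuous F) :
    Continuous fun p : X × (ι ⊕ ι → ℝ) =>
      boxInf F p.1 (fun i => p.2 (.inl i)) fun i => p.2 (.inr i) := by
  refine isCompact_unitBox.continuous_sInf
    (f := fun (p : X × (ι ⊕ ι → ℝ)) θ => F (p.1, boxPoint (fun i => p.2 (.inl i))
      (fun i => p.2 (.inr i)) θ)) (hF.comp ?_)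
  unfold boxPoint
  fun_prop

lemma bddBelow_image (hF : Continuous F) (x : X) (s t : ι → ℝ) :
    BddBelow ((fun ξ => F (x, ξ)) '' Set.Icc s t) := by
  have hc : IsCompact (Set.Icc s t) := by
    rw [← Set.pi_univ_Icc]
    exact isCompact_univ_pi fun _ => isCompact_Icc
  exact (hc.image (by fun_prop : Continuous fun ξ => F (x, ξ))).bddBelow

lemma boxInf_le (hF : Continuous F) {x : X} {s t ξ : ι → ℝ} (hs : s ≤ ξ) (ht : ξ ≤ t) :
    boxInf F x s t ≤ F (x, ξ) := by
  rw [boxInf, image_comp_boxPoint F x (hs.trans ht)]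
  exact csInf_le (bddBelow_image hF x s t) ⟨ξ, ⟨hs, ht⟩, rfl⟩

lemma boxInf_mono (hF : Continuous F) {x : X} {s t s' t' : ι → ℝ} (hs : s ≤ s') (ht : t' ≤ t)
    (hst : s' ≤ t') : boxInf F x s t ≤ boxInf F x s' t' := by
  rw [boxInf, boxInf, image_comp_boxPoint F x hst,
    image_comp_boxPoint F x (hs.trans (hst.trans ht))]
  exact csInf_le_csInf (bddBelow_image hF x s t) ((Set.nonempty_Icc.2 hst).image _)
    (Set.image_mono (Set.Icc_subset_Icc hs ht))

variable {n : ℕ} {Ω : Opens (E n)}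

/-- A continuous function of finitely many squeezed functions is squeezed, from below, by the
minima over the boxes that the given intervals span, and, from above, by the maxima. -/
lemma exists_isSqueeze_comp [Finite ι] {F : Ω × (ι → ℝ) → ℝ} (hF : Continuous F)
    {a b : ι → ℕ → ML Ω 0} (hab : ∀ p, IsSqueeze (a p) (b p)) :
    ∃ u v : ℕ → ML Ω 0, IsSqueeze u v ∧ ∀ (r : ℕ) (w : ι → ML Ω 0) (z : ML Ω 0),
      (∀ p, w p ∈ Set.Icc (a p r) (b p r)) →
      (∀ᶠ x in residual Ω, z.1 x = F (x, fun p => ((w p).1 x).toReal)) →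
      z ∈ Set.Icc (u r) (v r) := by
  have hG : Continuous fun x => -F x := hF.neg
  have hG' : Continuous fun p : Ω × (ι ⊕ ι → ℝ) =>
      -boxInf (fun x => -F x) p.1 (fun i => p.2 (.inl i)) fun i => p.2 (.inr i) :=
    (continuous_boxInf hG).neg
  choose u hu using fun r => exists_ML_comp (continuous_boxInf hF)
    (Sum.elim (fun p => a p r) fun p => b p r)
  choose v hv using fun r => exists_ML_comp hG'
    (Sum.elim (fun p => a p r) fun p => b p r)
  simp only [Sum.elim_inl, Sum.elim_inr] at hu hv
  refine ⟨u, v, ?_, fun r w z hw hz => ⟨ML.le_iff_residual.2 ?_, ML.le_iff_residual.2 ?_⟩⟩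
  · filter_upwards [eventually_countable_forall.2 hu, eventually_countable_forall.2 hv,
      eventually_all.2 hab] with x hux hvx hx
    choose α β y h1 h2 h3 h4 h5 h6 using hx
    simp only [h1, h2, EReal.toReal_coe] at hux hvx
    have hle : ∀ r, (fun p => α p r) ≤ fun p => β p r := fun r p =>
      ((h3 p).ge_of_tendsto (h5 p) r).trans ((h4 p).le_of_tendsto (h6 p) r)
    have hlim : Tendsto (fun r => (x, Sum.elim (fun p => α p r) fun p => β p r)) atTop
        (𝓝 (x, Sum.elim y y)) := by
      refine tendsto_const_nhds.prodMk_nhds (tendsto_pi_nhds.2 ?_)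
      rintro (p | p)
      exacts [h5 p, h6 p]
    have hlow := ((continuous_boxInf hF).tendsto _).comp hlim
    have hupp := (hG'.tendsto _).comp hlim
    simp only [Function.comp_def, Sum.elim_inl, Sum.elim_inr, boxInf_self, neg_neg] at hlow hupp
    exact ⟨_, _, F (x, y), hux, hvx,
      fun r s hrs => boxInf_mono hF (fun p => h3 p hrs) (fun p => h4 p hrs) (hle s),
      fun r s hrs => neg_le_neg
        (boxInf_mono hG (fun p => h3 p hrs) (fun p => h4 p hrs) (hle s)), hlow, hupp⟩
  all_goals
    have hbox : ∀ᶠ x in residual Ω, ∀ p, ((a p r).1 x).toReal ≤ ((w p).1 x).toReal ∧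
        ((w p).1 x).toReal ≤ ((b p r).1 x).toReal := by
      refine eventually_all.2 fun p => ?_
      filter_upwards [(a p r).eventually_coe_toReal, (b p r).eventually_coe_toReal,
        (w p).eventually_coe_toReal] with x h1 h2 h3
      rw [← EReal.coe_le_coe_iff, ← EReal.coe_le_coe_iff, h1, h2, h3]
      exact ⟨(hw p).1 x, (hw p).2 x⟩
  · filter_upwards [hbox, hu r, hz] with x hx hux hzx
    rw [hux, hzx, EReal.coe_le_coe_iff]
    exact boxInf_le hF (fun p => (hx p).1) fun p => (hx p).2
  · filter_upwards [hbox, hv r, hz] with x hx hvx hzx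
    rw [hvx, hzx, EReal.coe_le_coe_iff]
    exact le_neg.1 (boxInf_le hG (fun p => (hx p).1) fun p => (hx p).2)

/-- To check that `T` maps into the order structure the filters that the maps `D p` map into the
order structure, it suffices to consider the filters which each `D p` maps to the square of a
single filter generated by squeezing intervals. -/
lemma map_mem_orderStructure_of_initial [Finite ι] {X : Type} (D : ι → X → ML Ω 0)
    (T : X → ML Ω 0)
    (hT : ∀ a b : ι → ℕ → ML Ω 0, (∀ p, IsSqueeze (a p) (b p)) →
      ∃ u v, IsSqueeze u v ∧
        map T (⨅ p, comap (D p) (intervalFilter (a p) (b p))) ≤ intervalFilter u v)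
    {U : Filter (X × X)} (hU : ∀ p, map (Prod.map (D p) (D p)) U ∈ orderStructure Ω) :
    map (Prod.map T T) U ∈ orderStructure Ω := by
  classical
  have := Fintype.ofFinite ι
  -- The maps are treated one after the other: `s` holds those that are still to be reduced.
  have key : ∀ (s : Finset ι) (U : Filter (X × X)),
      (∀ p ∈ s, map (Prod.map (D p) (D p)) U ∈ orderStructure Ω) →
      (∀ p ∉ s, ∃ a b, IsSqueeze a b ∧
        map (Prod.map (D p) (D p)) U ≤ intervalFilter a b ×ˢ intervalFilter a b) →
      map (Prod.map T T) U ∈ orderStructure Ω := by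
    intro s
    induction s using Finset.induction_on with
    | empty =>
      intro U _ h
      choose a b hab hle using fun p => h p (Finset.notMem_empty p)
      obtain ⟨u, v, huv, h'⟩ := hT a b hab
      refine orderStructure_mono (prod_intervalFilter_mem huv) (le_trans ?_ (prod_mono h' h'))
      rw [prod_map_map_eq']
      refine map_mono ?_
      have hside : ∀ π : X × X → X, (∀ p, map (D p ∘ π) U ≤ intervalFilter (a p) (b p)) →
          U ≤ comap π (⨅ p, comap (D p) (intervalFilter (a p) (b p))) := fun π hπ => by
        rw [← map_le_iff_le_comap]
        refine le_iInf fun p => ?_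
        rw [← map_le_iff_le_comap, map_map]
        exact hπ p
      refine le_inf (hside Prod.fst fun p => ?_) (hside Prod.snd fun p => ?_)
      · exact (map_mono (m := Prod.fst) (hle p)).trans tendsto_fst
      · exact (map_mono (m := Prod.snd) (hle p)).trans tendsto_snd
    | insert q s hq ih =>
      intro U h1 h2
      have hstep : ∀ W ∈ orderStructure Ω, ∀ V ≤ U, map (Prod.map (D q) (D q)) V ≤ W →
          map (Prod.map T T) V ∈ orderStructure Ω := fun W hW => by
        refine orderStructure_induction (P := fun W => ∀ V ≤ U,
          map (Prod.map (D q) (D q)) V ≤ W → map (Prod.map T T) V ∈ orderStructure Ω)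
          (fun W W' hW hW' V hV hVW => hW V hV (hVW.trans hW')) (fun V _ hVW => ?_)
          (fun W W' hW hW' V hV hVW => ?_) (fun a b hab V hV hVW => ?_) hW
        · rw [le_bot_iff, map_eq_bot_iff] at hVW
          rw [hVW, Filter.map_bot]
          exact bot_mem_orderStructure
        · rw [map_le_iff_le_comap, comap_sup] at hVW
          rw [← inf_eq_left.2 hVW, inf_sup_left, map_sup]
          exact orderStructure_sup
            (hW _ (inf_le_left.trans hV) (map_le_iff_le_comap.2 inf_le_right))
            (hW' _ (inf_le_left.trans hV) (map_le_iff_le_comap.2 inf_le_right))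
        · refine ih V (fun p hp => orderStructure_mono (h1 p (Finset.mem_insert_of_mem hp))
            (map_mono hV)) fun p hp => ?_
          by_cases hpq : p = q
          · subst hpq
            exact ⟨a, b, hab, hVW⟩
          · obtain ⟨a, b, hab, hle⟩ := h2 p (by simp [hpq, hp])
            exact ⟨a, b, hab, (map_mono hV).trans hle⟩
      exact hstep _ (h1 q (Finset.mem_insert_self q s)) U le_rfl le_rfl
  exact key Finset.univ U (fun p _ => hU p) fun p hp => (hp (Finset.mem_univ p)).elim

variable {m K : ℕ}

lemma unifContinuous_operatorT (F : Ω × (Fin K × MultiIndex n m → ℝ) → Fin K → ℝ)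
    (hF : Continuous F) :
    UnifContinuous (productStructure (Fin K) (initialStructure Ω m))
      (productStructure (Fin K) (orderStructure Ω)) (operatorT F hF) := by
  intro U hU j
  have hFj : Continuous fun x => F x j := (continuous_apply j).comp hF
  rw [map_map, Prod.map_comp_map]
  refine map_mem_orderStructure_of_initial
    (fun (p : Fin K × MultiIndex n m) (u : Fin K → ML Ω m) => extD p.2 (u p.1)) _
    (fun a b hab => ?_) fun p => ?_
  · obtain ⟨u, v, huv, h⟩ := exists_isSqueeze_comp hFj hab
    refine ⟨u, v, huv, le_iInf fun r => le_principal_iff.2 (mem_map.2 ?_)⟩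
    have hmem : (⋂ p : Fin K × MultiIndex n m, (fun u : Fin K → ML Ω m => extD p.2 (u p.1)) ⁻¹'
        Set.Icc (a p r) (b p r)) ∈ ⨅ p : Fin K × MultiIndex n m,
          comap (fun u : Fin K → ML Ω m => extD p.2 (u p.1)) (intervalFilter (a p) (b p)) :=
      iInter_mem.2 fun p => mem_iInf_of_mem p
        (preimage_mem_comap (Icc_mem_intervalFilter (a p) (b p) r))
    refine mem_of_superset hmem fun w hw => h r (fun p => extD p.2 (w p.1)) _
      (Set.mem_iInter.1 hw) ?_
    exact eventually_baireIS_comp hFj fun p : Fin K × MultiIndex n m => extD p.2 (w p.1)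
  · have := hU p.1 p.2
    rwa [map_map, Prod.map_comp_map] at this

end Operator

end OrderCompletion

open OrderCompletion in
theorem mainTheorem2 (n m K : ℕ) (Ω : TopologicalSpace.Opens (EuclideanSpace ℝ (Fin n)))
    (F : Ω × (Fin K × MultiIndex n m → ℝ) → Fin K → ℝ) (hF : Continuous F) :
    -- uniform continuity
    UnifContinuous (productStructure (Fin K) (initialStructure Ω m))
      (productStructure (Fin K) (orderStructure Ω)) (operatorT F hF) ∧
    -- both spaces have completions
    (∃ (X' : Type) (J' : Set (Filter (X' × X'))) (ψ : (Fin K → ML Ω m) → X'),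
      IsCompletion (productStructure (Fin K) (initialStructure Ω m)) J' ψ) ∧
    (∃ (Y' : Type) (J' : Set (Filter (Y' × Y'))) (φ : (Fin K → ML Ω 0) → Y'),
      IsCompletion (productStructure (Fin K) (orderStructure Ω)) J' φ) ∧
    -- unique uniformly continuous extension to the completions
    (∀ (X' Y' : Type) (JX : Set (Filter (X' × X'))) (JY : Set (Filter (Y' × Y')))
      (ψ : (Fin K → ML Ω m) → X') (φ : (Fin K → ML Ω 0) → Y'),
      IsCompletion (productStructure (Fin K) (initialStructure Ω m)) JX ψ →
      IsCompletion (productStructure (Fin K) (orderStructure Ω)) JY φ →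
      ∃! Tsharp : X' → Y', UnifContinuous JX JY Tsharp ∧
        Tsharp ∘ ψ = φ ∘ operatorT F hF) := by
  have hO := isUniformConvergenceStructure_orderStructure Ω
  have hT := unifContinuous_operatorT F hF
  refine ⟨hT, ?_, ?_, ?_⟩
  · exact exists_isCompletion_productStructure _
      (isUniformConvergenceStructure_initialStructure Ω m) (isHausdorff_initialStructure Ω m)
  · exact exists_isCompletion_productStructure _ hO (isHausdorff_orderStructure Ω)
  · intro X' Y' JX JY ψ φ hψ hφ
    refine hψ.extend Y' JY hφ.isUCS hφ.hausdorff hφ.complete (φ ∘ operatorT F hF) fun U hU => ?_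
    rw [← Prod.map_comp_map, ← map_map]
    exact (hφ.embedding _).1 (hT U hU)
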